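/- **Theorem (Asymptotic normality for Boulevard predictions).** Let $d\ge 1$, $\lambda\in(0,1)$. *Random design.* Let $(x_i,\epsilon_i)_{i\ge1}$ be i.i.d. pairs with $x_i$ independent of $\epsilon_i$, where $x_i\in[0,1]^d$ has a density $\mu$ with respect to Lebesgue measure on $[0,1]^d$ with $0<c_1\le\mu\le c_2<\infty$, and $\epsilon_i$ is sub-Gaussian with $\mathbb E\epsilon_i=0$, $\mathbb E\epsilon_i^2=\sigma_\epsilon^2$. Let $y_i=f(x_i)+\epsilon_i$, where $f$ is Lipschitz (hence bounded) on $[0,1]^d$. The sample of size $n$ is $(x_1,y_1),\dots,(x_n,y_n)$. *Trees.* A tree structure is a finite partition $q=\{A_1,\dots,A_m\}$ of $[0,1]^d$ into hyper-rectangles (leaves). For a subsample $w\subseteq\{1,\dots,n\}$ and a point $z\in A\in q$, the structure vector $s_n(z)=s_n(z;q,w)\in\mathbb R^n$ has entries $s_{n,k}(z)=I(x_k\in A)I(k\in w)\big/\sum_{i}I(x_i\in A)I(i\in w)$, with $0/0=0$. For each $n$ let $Q_n$ be a finite set of tree structures (not depending on the sample) and let $\mathcal Q_n$ be a probability distribution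 on $Q_n$ that may depend (measurably) on the sample, but only through the covariates $x_1,\dots,x_n$ (structure-value isolation). On the sample of size $n$, trees are grown successively: given the sample and the first $b$ tree structures and subsamples, the next tree structure has distribution $\mathcal Q_n$ for every $b\ge0$ (non-adaptivity), and, given in addition this structure, the next subsample is uniform on the index sets of size $m_n$, where $m_n\le n$ and $m_n\ge n^{\frac{d+1}{d+2}}\log n$ for all large $n$ ($m_n=n$ means no subsampling). *Boulevard.* Let $M=M_n\in[0,\infty]$ be a truncation level, depending measurably on the sample, with $M\ge\frac1{1-\lambda}\max_{i\le n}|y_i|$, and $\Gamma_M(u)=\mathrm{sign}(u)(|u|\wedge M)$ ($M=\infty$ means no truncation). Put $\hat f_{0}=0$ and, for $b\ge1$, $$\hat f_{b}(z)=\tfrac{b-1}{b}\hat f_{b-1}(z)+\tfrac{\lambda}{b}\sum_{k=1}^n s_{n,k}(z;q_b,w_b)\bigl(y_k-\Gamma_M(\hat f_{b-1}(x_k))\bigr),$$ where $q_b,w_b$ are the $b$-th tree structure and subsample, and let $\hat f_n(z)=\lim_{b\to\infty}\hat f_b(z)$. *Rates.* Assume that for some $\varepsilon_1,\nu,\alpha>0$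 $$\sup_{A\in q\in Q_n}\mathrm{diam}(A)=O\bigl(n^{-\frac1{d+2}-\varepsilon_1}\bigr),\qquad \inf_{A\in q\in Q_n}\mathrm{vol}(A)=\Omega\bigl(n^{-\frac{d+1}{d+2}+\nu}\bigr),$$ $$|Q_n|=O\Bigl(\tfrac1n\exp\bigl(\tfrac12 n^{\frac1{d+2}-\nu}-n^{\alpha}\bigr)\Bigr).$$ *Conclusion.* Fix $x\in[0,1]^d$. Let $k_n=\mathbb E_{q,w}[s_n(x)]$ be the expected structure vector of $x$ given the sample, $K_n$ the $n\times n$ matrix whose $i$-th row is $\mathbb E_{q,w}[s_n(x_i)]^T$, and $r_n^T=k_n^T\bigl[\frac1\lambda I+K_n\bigr]^{-1}$. Then for every $n$ the limit $\hat f_n(x)$ exists almost surely, and, as $n\to\infty$, $$\frac{\hat f_n(x)-\frac{\lambda}{1+\lambda}f(x)}{\|r_n\|}\ \xrightarrow{\ d\ }\ N(0,\sigma_\epsilon^2).$$ -/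

import Mathlib

open MeasureTheory ProbabilityTheory Filter Topology Asymptotics
open scoped ENNReal NNReal

noncomputable section

namespace Boulevard

/-- The space `ℝ^d` of covariates, with the Euclidean norm. -/
abbrev Cov (d : ℕ) := EuclideanSpace ℝ (Fin d)

/-- The covariate domain `[0,1]^d`. -/
def unitCube (d : ℕ) : Set (Cov d) := {x | ∀ j, x j ∈ Set.Icc (0 : ℝ) 1}

/-- A hyper-rectangle: a product of (open, closed or half-open) intervals. -/
def IsHyperrectangle {d : ℕ} (A : Set (Cov d)) : Prop :=
  ∃ I : Fin d → Set ℝ, (∀ j, (I j).OrdConnected) ∧ A = {x | ∀ j, x j ∈ I j}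

/-- A tree structure: a finite partition of `[0,1]^d` into hyper-rectangles, the leaves. -/
structure TreeStructure (d : ℕ) where
  leaves : Finset (Set (Cov d))
  hyperrectangle : ∀ A ∈ leaves, IsHyperrectangle A
  disjoint : (leaves : Set (Set (Cov d))).PairwiseDisjoint id
  cover : ⋃ A ∈ leaves, A = unitCube d

/-- The points `x` and `y` lie in the same leaf of `q`. -/
def TreeStructure.SameLeaf {d : ℕ} (q : TreeStructure d) (x y : Cov d) : Prop :=
  ∃ A ∈ q.leaves, x ∈ A ∧ y ∈ A

/-- A sample `(x_1, y_1), …, (x_n, y_n)`. -/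
abbrev Sample (d n : ℕ) := Fin n → Cov d × ℝ

open Classical in
/-- The structure vector `s_n(z; w)` of the point `z` for the tree structure `q` and the subsample
`w`: its `k`-th entry is `I(x_k ∈ A) I(k ∈ w) / ∑_i I(x_i ∈ A) I(i ∈ w)`, where `A` is the leaf
that contains `z`, and `0 / 0 = 0`. -/
def structureVector {d n : ℕ} (s : Sample d n) (q : TreeStructure d) (w : Finset (Fin n))
    (z : Cov d) (k : Fin n) : ℝ :=
  (if q.SameLeaf z (s k).1 ∧ k ∈ w then 1 else 0) /
    (Finset.card {i | q.SameLeaf z (s i).1 ∧ i ∈ w} : ℝ)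

/-- The truncation `Γ_M(u) = sign(u) (|u| ∧ M)`, where `M = ∞` means no truncation. -/
def truncate (M : ℝ≥0∞) (u : ℝ) : ℝ :=
  (SignType.sign u : ℝ) * (min (ENNReal.ofReal |u|) M).toReal

/-- The Boulevard iteration with learning rate `lam` and truncation level `M` on the sample `s`,
for given sequences of tree structures and subsamples (the entry `b` of either sequence is the one
used in the iteration `b + 1`): `f̂_0 = 0` and
`f̂_{b+1}(z) = b/(b+1) f̂_b(z) + lam/(b+1) ∑_k s_{n,k}(z) (y_k - Γ_M(f̂_b(x_k)))`. -/
def iterate {d n : ℕ} (lam : ℝ) (M : ℝ≥0∞) (s : Sample d n) (tree : ℕ → TreeStructure d)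
    (sub : ℕ → Finset (Fin n)) : ℕ → Cov d → ℝ
  | 0 => fun _ => 0
  | b + 1 => fun z =>
      (b : ℝ) / (b + 1) * iterate lam M s tree sub b z +
        lam / (b + 1) * ∑ k, structureVector s (tree b) (sub b) z k *
          ((s k).2 - truncate M (iterate lam M s tree sub b (s k).1))

/-- The limit `f̂(z) = lim_{b → ∞} f̂_b(z)` of the Boulevard iterations. -/
def prediction {d n : ℕ} (lam : ℝ) (M : ℝ≥0∞) (s : Sample d n) (tree : ℕ → TreeStructure d)
    (sub : ℕ → Finset (Fin n)) (z : Cov d) : ℝ :=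
  limUnder atTop (fun b : ℕ => iterate lam M s tree sub b z)

/-- The expected structure vector `𝔼_{q,w}[s_n(z)]`, for a tree structure `q` drawn from the
distribution `law` on the finite tree space `Q` and an independent subsample `w` drawn uniformly
from the subsets of size `m`. At the point of interest this is `k_n`. -/
def expectedStructureVector {d n : ℕ} (s : Sample d n) {Q : Finset (TreeStructure d)}
    (law : PMF Q) (m : ℕ) (z : Cov d) (k : Fin n) : ℝ :=
  ∑ q : Q, ∑ w ∈ Finset.powersetCard m (Finset.univ : Finset (Fin n)),
    (law q).toReal * (1 / (n.choose m : ℝ)) * structureVector s q.1 w z k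

/-- The matrix `K_n = 𝔼_{q,w}[S_n]`, whose rows are the expected structure vectors of the sample
points. -/
def kernelMatrix {d n : ℕ} (s : Sample d n) {Q : Finset (TreeStructure d)}
    (law : PMF Q) (m : ℕ) : Matrix (Fin n) (Fin n) ℝ :=
  Matrix.of fun i k => expectedStructureVector s law m (s i).1 k

/-- The vector `r_n` given by `r_n^T = k_n^T [(1/lam) I + K_n]⁻¹`. -/
def ridgeWeights {d n : ℕ} (lam : ℝ) (s : Sample d n) {Q : Finset (TreeStructure d)}
    (law : PMF Q) (m : ℕ) (z : Cov d) : EuclideanSpace ℝ (Fin n) :=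
  WithLp.toLp 2 (Matrix.vecMul (expectedStructureVector s law m z)
    ((1 / lam) • (1 : Matrix (Fin n) (Fin n) ℝ) + kernelMatrix s law m)⁻¹)

/-- The random sample of size `n` from the regression model `y_i = f(x_i) + ε_i`. -/
def sample {Ω : Type*} {d : ℕ} (f : Cov d → ℝ) (X : ℕ → Ω → Cov d) (ε : ℕ → Ω → ℝ)
    (n : ℕ) (ω : Ω) : Sample d n :=
  fun i => (X i ω, f (X i ω) + ε i ω)

/-- The σ-algebra generated by a sample `S` of size `n` and by the first `b` trees grown on it
(their structures and their subsamples). -/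
@[reducible] def history {Ω : Type*} {d n : ℕ} {Q : Finset (TreeStructure d)} (S : Ω → Sample d n)
    (tree : ℕ → Ω → Q) (sub : ℕ → Ω → Finset (Fin n)) (b : ℕ) : MeasurableSpace Ω :=
  MeasurableSpace.comap S inferInstance ⊔
    ⨆ j ∈ Finset.range b, (MeasurableSpace.comap (tree j) ⊤ ⊔ MeasurableSpace.comap (sub j) ⊤)

/-- Non-adaptivity: given the sample and the first `b` trees, the next tree structure has the
distribution `law (sample)` on the tree space `Q`, the same for all `b`. -/
def NonAdaptive {Ω : Type*} [MeasurableSpace Ω] (P : Measure Ω) {d n : ℕ}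
    {Q : Finset (TreeStructure d)} (law : Sample d n → PMF Q) (S : Ω → Sample d n)
    (tree : ℕ → Ω → Q) (sub : ℕ → Ω → Finset (Fin n)) : Prop :=
  ∀ (b : ℕ) (q : Q),
    P[Set.indicator {ω | tree b ω = q} (fun _ => (1 : ℝ)) | history S tree sub b]
      =ᵐ[P] fun ω => (law (S ω) q).toReal

/-- Structure-value isolation: given the covariates, the tree structures do not depend on the
responses, i.e. their distribution given the sample is a function of the covariates. -/
def StructureValueIsolation {d n : ℕ} {Q : Finset (TreeStructure d)}
    (law : Sample d n → PMF Q) : Prop :=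
  ∀ s s' : Sample d n, (∀ i, (s i).1 = (s' i).1) → law s = law s'

/-- Uniform subsampling: given the sample, the first `b` trees and the next tree structure, the
next subsample is uniformly distributed on the index sets of size `m`. -/
def UniformSubsampling {Ω : Type*} [MeasurableSpace Ω] (P : Measure Ω) {d n : ℕ}
    {Q : Finset (TreeStructure d)} (m : ℕ) (S : Ω → Sample d n)
    (tree : ℕ → Ω → Q) (sub : ℕ → Ω → Finset (Fin n)) : Prop :=
  ∀ (b : ℕ) (w : Finset (Fin n)),
    P[Set.indicator {ω | sub b ω = w} (fun _ => (1 : ℝ)) |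
        history S tree sub b ⊔ MeasurableSpace.comap (tree b) ⊤]
      =ᵐ[P] fun _ => if w.card = m then 1 / (n.choose m : ℝ) else 0

/-- All leaves of all trees in `Q n` have diameter `O(n^{-1/(d+2) - ε₁})`. -/
def LeafDiameterRate {d : ℕ} (Q : ℕ → Finset (TreeStructure d)) (ε₁ : ℝ) : Prop :=
  ∃ C : ℝ, ∀ᶠ n : ℕ in atTop, ∀ q ∈ Q n, ∀ A ∈ q.leaves,
    Metric.diam A ≤ C * (n : ℝ) ^ (-(1 / ((d : ℝ) + 2)) - ε₁)

/-- All leaves of all trees in `Q n` have volume `Ω(n^{-(d+1)/(d+2) + ν})`. -/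
def LeafVolumeRate {d : ℕ} (Q : ℕ → Finset (TreeStructure d)) (ν : ℝ) : Prop :=
  ∃ c : ℝ, 0 < c ∧ ∀ᶠ n : ℕ in atTop, ∀ q ∈ Q n, ∀ A ∈ q.leaves,
    c * (n : ℝ) ^ (-(((d : ℝ) + 1) / ((d : ℝ) + 2)) + ν) ≤ (volume A).toReal

/-- `|Q n| = O((1/n) exp((1/2) n^{1/(d+2) - ν} - n^α))`. -/
def TreeSpaceRate {d : ℕ} (Q : ℕ → Finset (TreeStructure d)) (ν α : ℝ) : Prop :=
  (fun n : ℕ => ((Q n).card : ℝ)) =O[atTop] fun n : ℕ =>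
    1 / (n : ℝ) * Real.exp (1 / 2 * (n : ℝ) ^ (1 / ((d : ℝ) + 2) - ν) - (n : ℝ) ^ α)

end Boulevard

end

/-! For a fixed sample the iteration is a stochastic approximation of a linear fixed-point equation.
The truncation never acts (`abs_iterate_le`), so b·f̂_b is λ times the sum of the first b trees,
each fitted to the residuals current when it was grown. A tree is its conditional mean given the
sample and the past plus an orthogonal increment, and the averages of these increments vanish almost
surely (`ae_tendsto_noise`). Since K_n is nonnegative with row sums at most 1, what is left is a
contraction by λ < 1 in the running averages of the residuals (`tendsto_zero_of_le_average`). Hence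
f̂_b(x) → k_nᵀ(I/λ + K_n)⁻¹y = r_nᵀy (`ae_tendsto_iterate`).

Uniform subsampling makes the mean weight constant on each leaf, so K_n is also symmetric and has
norm at most 1 both in ℓ^∞ and in ℓ². This gives ‖r_n‖_∞ ≤ λ/(1-λ)·‖k_n‖_∞ and ‖k_n‖₂ ≤
(1/λ+1)·‖r_n‖₂.

By Chernoff and a union bound, with probability tending to 1 every leaf holds at least a constant
times n^{1/(d+2)+ν} covariates. On that event k_n has small entries, mass close to 1 and support in
the ball around x whose radius is the diameter bound D_n. With N the number of covariates in that
ball, Cauchy–Schwarz gives 1 ≤ c‖r_n‖²N (`one_le_norm_ridgeWeights_sq_mul`), so (t/‖r_n‖)² ≤ c t² N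
for every t, while 𝔼N = O(n D_n^d). By Markov the ratio t/‖r_n‖ is negligible both for t a single
weight, of size O(n^{-1/(d+2)-ν}), and for t the bias, of size O(n^{-1/(d+2)-ε₁}). The centring
λ/(1+λ)·f(x) arises because K_n almost fixes Lipschitz functions, so that (I/λ + K_n)⁻¹ nearly
multiplies them by λ/(1+λ) (`abs_bias_le`).

By structure-value isolation r_n depends on the covariates only. Given them, r_nᵀε/‖r_n‖ is a sum of
independent errors with uniformly small weights of unit length; its characteristic function
converges to the Gaussian one (`tendstoInDistribution_weighted_sum`), and Slutsky's theorem adds the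
bias. -/

namespace Boulevard

/-! ### Ridge systems with substochastic matrices -/

section LinearAlgebra

variable {ι : Type*} [Fintype ι] {K : Matrix ι ι ℝ} {lam : ℝ}

lemma abs_mulVec_le (hK : ∀ i j, 0 ≤ K i j) (hrow : ∀ i, ∑ j, K i j ≤ 1) {u : ι → ℝ} {B : ℝ}
    (hB : 0 ≤ B) (hu : ∀ i, |u i| ≤ B) (i : ι) : |K.mulVec u i| ≤ B := by
  calc |K.mulVec u i| ≤ ∑ j, |K i j * u j| := Finset.abs_sum_le_sum_abs _ _
    _ ≤ ∑ j, K i j * B := by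
        refine Finset.sum_le_sum fun j _ => ?_
        rw [abs_mul, abs_of_nonneg (hK i j)]
        exact mul_le_mul_of_nonneg_left (hu j) (hK i j)
    _ = (∑ j, K i j) * B := by rw [Finset.sum_mul]
    _ ≤ 1 * B := mul_le_mul_of_nonneg_right (hrow i) hB
    _ = B := one_mul B

/-- The Schur test for a symmetric substochastic matrix. -/
lemma sum_mulVec_sq_le (hK : ∀ i j, 0 ≤ K i j) (hrow : ∀ i, ∑ j, K i j ≤ 1)
    (hsymm : K.IsSymm) (u : ι → ℝ) : ∑ i, (K.mulVec u i) ^ 2 ≤ ∑ i, u i ^ 2 := by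
  -- Cauchy–Schwarz with the entries of row `i` as weights, whose total is at most 1. Symmetry later
  -- bounds the column sums.
  have h1 : ∀ i, (K.mulVec u i) ^ 2 ≤ ∑ j, K i j * u j ^ 2 := by
    intro i
    have h := Finset.sum_sq_le_sum_mul_sum_of_sq_le_mul Finset.univ
      (r := fun j => K i j * u j) (f := fun j => K i j) (g := fun j => K i j * u j ^ 2)
      (fun j _ => hK i j) (fun j _ => mul_nonneg (hK i j) (sq_nonneg _)) (fun j _ => (by ring : _ = _).le)
    refine h.trans ?_
    have : 0 ≤ ∑ j, K i j * u j ^ 2 :=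
      Finset.sum_nonneg fun j _ => mul_nonneg (hK i j) (sq_nonneg _)
    nlinarith [hrow i]
  calc ∑ i, (K.mulVec u i) ^ 2 ≤ ∑ i, ∑ j, K i j * u j ^ 2 := Finset.sum_le_sum fun i _ => h1 i
    _ = ∑ j, (∑ i, K j i) * u j ^ 2 := by
        rw [Finset.sum_comm]
        refine Finset.sum_congr rfl fun j _ => ?_
        rw [Finset.sum_mul]
        exact Finset.sum_congr rfl fun i _ => by rw [hsymm.apply]
    _ ≤ ∑ j, u j ^ 2 := by
        refine Finset.sum_le_sum fun j _ => ?_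
        nlinarith [hrow j, sq_nonneg (u j)]

variable [DecidableEq ι]

lemma ridge_mulVec_apply (u : ι → ℝ) (i : ι) :
    ((1 / lam) • (1 : Matrix ι ι ℝ) + K).mulVec u i = 1 / lam * u i + K.mulVec u i := by
  simp [Matrix.add_mulVec, Matrix.smul_mulVec]

/-- The sup-norm bound for the solution of a ridge system with a substochastic matrix. -/
lemma abs_le_of_ridge_mulVec (hK : ∀ i j, 0 ≤ K i j) (hrow : ∀ i, ∑ j, K i j ≤ 1)
    (h0 : 0 < lam) (h1 : lam < 1) {u : ι → ℝ} {B : ℝ}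
    (hu : ∀ i, |((1 / lam) • (1 : Matrix ι ι ℝ) + K).mulVec u i| ≤ B) (i : ι) :
    |u i| ≤ lam / (1 - lam) * B := by
  have hlam : 0 < 1 - lam := by linarith
  have hle : ∀ j, |u j| ≤ ‖u‖ := fun j => norm_le_pi_norm u j
  have hB : 0 ≤ B := (abs_nonneg _).trans (hu i)
  -- Solve each equation for its diagonal unknown and use that `K` contracts the sup norm; `lam < 1`
  -- then absorbs ‖u‖ on the right.
  have key : ‖u‖ ≤ lam * (B + ‖u‖) := by
    refine (pi_norm_le_iff_of_nonneg (by positivity)).2 fun j => ?_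
    have h2 := hu j
    rw [ridge_mulVec_apply] at h2
    have h3 := abs_mulVec_le hK hrow (norm_nonneg u) hle j
    have h4 : |1 / lam * u j| ≤ B + ‖u‖ := by
      have := abs_sub_abs_le_abs_sub (1 / lam * u j) (-(K.mulVec u j))
      rw [sub_neg_eq_add, abs_neg] at this
      linarith
    rw [abs_mul, abs_of_pos (by positivity)] at h4
    rw [Real.norm_eq_abs]
    calc |u j| = lam * (1 / lam * |u j|) := by field_simp
      _ ≤ _ := by gcongr
  have : ‖u‖ ≤ lam / (1 - lam) * B := by
    rw [div_mul_eq_mul_div, le_div_iff₀ hlam]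
    linarith
  exact (hle i).trans this

/-- The sup-norm bound with right-hand side 0 gives injectivity. -/
lemma isUnit_ridge (hK : ∀ i j, 0 ≤ K i j) (hrow : ∀ i, ∑ j, K i j ≤ 1)
    (h0 : 0 < lam) (h1 : lam < 1) :
    IsUnit ((1 / lam) • (1 : Matrix ι ι ℝ) + K) := by
  rw [← Matrix.mulVec_injective_iff_isUnit]
  intro u v huv
  have h : ∀ i, |((1 / lam) • (1 : Matrix ι ι ℝ) + K).mulVec (u - v) i| ≤ 0 := by
    intro i
    rw [Matrix.mulVec_sub, huv]
    simp
  funext i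
  have := abs_le_of_ridge_mulVec hK hrow h0 h1 h i
  rw [mul_zero] at this
  have h2 := abs_nonpos_iff.1 this
  simpa [sub_eq_zero] using h2

lemma ridge_mulVec_inv_mulVec (hK : ∀ i j, 0 ≤ K i j) (hrow : ∀ i, ∑ j, K i j ≤ 1)
    (h0 : 0 < lam) (h1 : lam < 1) (v : ι → ℝ) :
    ((1 / lam) • (1 : Matrix ι ι ℝ) + K).mulVec
      (((1 / lam) • (1 : Matrix ι ι ℝ) + K)⁻¹.mulVec v) = v := by
  have := isUnit_ridge hK hrow h0 h1
  rw [Matrix.mulVec_mulVec, Matrix.mul_nonsing_inv _ ((Matrix.isUnit_iff_isUnit_det _).1 this),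
    Matrix.one_mulVec]

/-- Lets the row vector r_nᵀ be treated as the solution of a ridge system with right-hand side k_n.
-/
lemma vecMul_inv_ridge (hsymm : K.IsSymm) (v : ι → ℝ) :
    Matrix.vecMul v ((1 / lam) • (1 : Matrix ι ι ℝ) + K)⁻¹ =
      ((1 / lam) • (1 : Matrix ι ι ℝ) + K)⁻¹.mulVec v := by
  rw [← Matrix.mulVec_transpose, Matrix.transpose_nonsing_inv]
  simp [hsymm.eq]

/-- A ridge solution is at least as large as its right-hand side, up to a constant. -/
lemma norm_le_norm_ridge (hK : ∀ i j, 0 ≤ K i j) (hrow : ∀ i, ∑ j, K i j ≤ 1)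
    (hsymm : K.IsSymm) (h0 : 0 < lam) (u : ι → ℝ) :
    ‖WithLp.toLp 2 (((1 / lam) • (1 : Matrix ι ι ℝ) + K).mulVec u)‖ ≤
      (1 / lam + 1) * ‖WithLp.toLp 2 u‖ := by
  have h1 : ((1 / lam) • (1 : Matrix ι ι ℝ) + K).mulVec u = (1 / lam) • u + K.mulVec u := by
    funext i; simpa using ridge_mulVec_apply u i
  have h2 : ‖WithLp.toLp 2 (K.mulVec u)‖ ≤ ‖WithLp.toLp 2 u‖ := by
    rw [EuclideanSpace.norm_eq, EuclideanSpace.norm_eq]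
    simpa using Real.sqrt_le_sqrt (sum_mulVec_sq_le hK hrow hsymm u)
  rw [h1, WithLp.toLp_add, WithLp.toLp_smul]
  refine (norm_add_le _ _).trans ?_
  rw [norm_smul, Real.norm_of_nonneg (by positivity)]
  linarith

end LinearAlgebra

/-! ### Structure vectors and their averages over subsamples -/

section StructureVector

variable {d n : ℕ}

lemma isBounded_unitCube : Bornology.IsBounded (unitCube d) := by
  have : unitCube d ⊆ WithLp.ofLp ⁻¹' (Set.Icc (0 : Fin d → ℝ) 1) := by
    intro x hx
    exact ⟨fun j => (hx j).1, fun j => (hx j).2⟩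
  refine Bornology.IsBounded.subset ?_ this
  exact (PiLp.antilipschitzWith_ofLp 2 (fun _ : Fin d => ℝ)).isBounded_preimage
    (Metric.isBounded_Icc _ _)

lemma TreeStructure.SameLeaf.symm {q : TreeStructure d} {x y : Cov d} (h : q.SameLeaf x y) :
    q.SameLeaf y x := by
  obtain ⟨A, hA, hx, hy⟩ := h
  exact ⟨A, hA, hy, hx⟩

lemma TreeStructure.eq_of_mem {q : TreeStructure d} {A B : Set (Cov d)} (hA : A ∈ q.leaves)
    (hB : B ∈ q.leaves) {x : Cov d} (hxA : x ∈ A) (hxB : x ∈ B) : A = B := by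
  by_contra hne
  exact Set.disjoint_left.1 (q.disjoint hA hB hne) hxA hxB

lemma TreeStructure.sameLeaf_iff_mem {q : TreeStructure d} {A : Set (Cov d)} (hA : A ∈ q.leaves)
    {x y : Cov d} (hx : x ∈ A) : q.SameLeaf x y ↔ y ∈ A := by
  refine ⟨?_, fun hy => ⟨A, hA, hx, hy⟩⟩
  rintro ⟨B, hB, hxB, hyB⟩
  rwa [q.eq_of_mem hA hB hx hxB]

lemma TreeStructure.SameLeaf.iff {q : TreeStructure d} {x y : Cov d} (h : q.SameLeaf x y)
    (z : Cov d) : q.SameLeaf x z ↔ q.SameLeaf y z := by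
  obtain ⟨A, hA, hx, hy⟩ := h
  rw [q.sameLeaf_iff_mem hA hx, q.sameLeaf_iff_mem hA hy]

lemma TreeStructure.exists_mem_leaf (q : TreeStructure d) {x : Cov d} (hx : x ∈ unitCube d) :
    ∃ A ∈ q.leaves, x ∈ A := by
  rw [← q.cover] at hx
  simpa using hx

lemma TreeStructure.leaf_subset (q : TreeStructure d) {A : Set (Cov d)} (hA : A ∈ q.leaves) :
    A ⊆ unitCube d := by
  rw [← q.cover]
  exact Set.subset_biUnion_of_mem (u := fun A => A) hA

open Classical in
/-- The number of sample points in the leaf of `z`. -/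
noncomputable def leafCount (s : Sample d n) (q : TreeStructure d) (z : Cov d) : ℕ :=
  Finset.card {i | q.SameLeaf z (s i).1}

variable (s : Sample d n) (q : TreeStructure d) (w : Finset (Fin n))

lemma structureVector_nonneg (z : Cov d) (k : Fin n) : 0 ≤ structureVector s q w z k := by
  unfold structureVector
  split_ifs <;> positivity

lemma structureVector_eq_zero {z : Cov d} {k : Fin n} (h : ¬ q.SameLeaf z (s k).1) :
    structureVector s q w z k = 0 := by
  simp [structureVector, h]

open Classical in
lemma sum_structureVector (z : Cov d) :
    ∑ k, structureVector s q w z k = if ∃ i ∈ w, q.SameLeaf z (s i).1 then 1 else 0 := by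
  unfold structureVector
  rw [← Finset.sum_div, Finset.sum_boole]
  split_ifs with h
  · obtain ⟨i, hi, hz⟩ := h
    refine div_self ?_
    have : 0 < Finset.card {i | q.SameLeaf z (s i).1 ∧ i ∈ w} :=
      Finset.card_pos.2 ⟨i, by simp [hi, hz]⟩
    exact_mod_cast this.ne'
  · have : ({i | q.SameLeaf z (s i).1 ∧ i ∈ w} : Finset (Fin n)) = ∅ := by
      ext i
      simp only [Finset.mem_filter, Finset.mem_univ, true_and, Finset.notMem_empty, iff_false]
      exact fun hi => h ⟨i, hi.2, hi.1⟩
    simp [this]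

lemma sum_structureVector_le_one (z : Cov d) : ∑ k, structureVector s q w z k ≤ 1 := by
  classical
  rw [sum_structureVector]
  split_ifs <;> norm_num

lemma structureVector_congr {z z' : Cov d} (h : q.SameLeaf z z') (k : Fin n) :
    structureVector s q w z k = structureVector s q w z' k := by
  have h' : q.SameLeaf z = q.SameLeaf z' := funext fun y => propext (h.iff y)
  unfold structureVector
  rw [h']

/-- Relabelling the sample by a permutation that respects the leaf of `z` only moves the subsample;
this is the exchangeability behind the symmetry of K_n. -/
lemma structureVector_map (σ : Equiv.Perm (Fin n)) {z : Cov d}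
    (hσ : ∀ i, q.SameLeaf z (s (σ i)).1 ↔ q.SameLeaf z (s i).1) (k : Fin n) :
    structureVector s q (w.map σ.toEmbedding) z (σ k) = structureVector s q w z k := by
  classical
  unfold structureVector
  have h1 : (σ k ∈ w.map σ.toEmbedding) ↔ k ∈ w := by simp
  have h2 : Finset.card {i | q.SameLeaf z (s i).1 ∧ i ∈ w.map σ.toEmbedding} =
      Finset.card {i | q.SameLeaf z (s i).1 ∧ i ∈ w} := by
    rw [← Finset.card_map (s := ({i | q.SameLeaf z (s i).1 ∧ i ∈ w} : Finset (Fin n)))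
      σ.toEmbedding]
    congr 1
    ext i
    obtain ⟨j, rfl⟩ := σ.surjective i
    simp [hσ]
  rw [h2]
  simp only [hσ, h1]

variable (m : ℕ)

/-- The structure vector averaged over the uniform subsample of size `m`. -/
noncomputable def subsampleMean (z : Cov d) (k : Fin n) : ℝ :=
  ∑ w ∈ Finset.powersetCard m (Finset.univ : Finset (Fin n)),
    1 / (n.choose m : ℝ) * structureVector s q w z k

lemma subsampleMean_nonneg (z : Cov d) (k : Fin n) : 0 ≤ subsampleMean s q m z k :=
  Finset.sum_nonneg fun w _ => mul_nonneg (by positivity) (structureVector_nonneg s q w z k)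

/-- Transposing the two indices permutes the index sets of size `m` and exchanges the two weights.
-/
lemma subsampleMean_eq_of_sameLeaf {z : Cov d} {i j : Fin n} (hi : q.SameLeaf z (s i).1)
    (hj : q.SameLeaf z (s j).1) : subsampleMean s q m z i = subsampleMean s q m z j := by
  unfold subsampleMean
  refine Finset.sum_equiv (Equiv.finsetCongr (Equiv.swap i j)) (fun w => ?_) (fun w _ => ?_)
  · simp [Finset.mem_powersetCard]
  · congr 1
    have h := structureVector_map s q w (Equiv.swap i j) (z := z) (fun k => ?_) i
    · rw [Equiv.swap_apply_left] at h
      exact h.symm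
    · rcases eq_or_ne k i with rfl | hki
      · simp [hi, hj]
      · rcases eq_or_ne k j with rfl | hkj
        · simp [hi, hj]
        · rw [Equiv.swap_apply_of_ne_of_ne hki hkj]

lemma subsampleMean_symm (i j : Fin n) :
    subsampleMean s q m (s i).1 j = subsampleMean s q m (s j).1 i := by
  by_cases h : q.SameLeaf (s i).1 (s j).1
  · have h1 : subsampleMean s q m (s i).1 j = subsampleMean s q m (s j).1 j := by
      unfold subsampleMean
      simp only [structureVector_congr s q _ h]
    rw [h1]
    exact subsampleMean_eq_of_sameLeaf s q m ((h.iff _).1 h) h.symm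
  · have h' : ¬ q.SameLeaf (s j).1 (s i).1 := fun h' => h h'.symm
    simp [subsampleMean, structureVector_eq_zero s q _ h, structureVector_eq_zero s q _ h']

lemma sum_subsampleMean (z : Cov d) :
    ∑ k, subsampleMean s q m z k = ∑ w ∈ Finset.powersetCard m (Finset.univ : Finset (Fin n)),
      1 / (n.choose m : ℝ) * ∑ k, structureVector s q w z k := by
  unfold subsampleMean
  rw [Finset.sum_comm]
  simp only [Finset.mul_sum]

lemma sum_subsampleMean_le_one (z : Cov d) : ∑ k, subsampleMean s q m z k ≤ 1 := by
  rw [sum_subsampleMean]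
  calc _ ≤ ∑ w ∈ Finset.powersetCard m (Finset.univ : Finset (Fin n)), 1 / (n.choose m : ℝ) * 1 :=
        Finset.sum_le_sum fun w _ =>
          mul_le_mul_of_nonneg_left (sum_structureVector_le_one s q w z) (by positivity)
    _ ≤ 1 := by
        simp only [mul_one, Finset.sum_const, Finset.card_powersetCard, Finset.card_univ,
          Fintype.card_fin, nsmul_eq_mul, mul_one_div]
        -- An inequality rather than an equality, since for `m > n` the binomial coefficient is 0
        -- and so is the quotient.
        exact div_self_le_one _

/-- The mean weights are equal over the leaf and their sum is at most 1. -/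
lemma subsampleMean_mul_leafCount_le_one (z : Cov d) (k : Fin n) :
    subsampleMean s q m z k * leafCount s q z ≤ 1 := by
  classical
  by_cases h : q.SameLeaf z (s k).1
  · calc subsampleMean s q m z k * leafCount s q z
        = ∑ i : Fin n with q.SameLeaf z (s i).1, subsampleMean s q m z i := by
          rw [Finset.sum_congr rfl fun i hi =>
            subsampleMean_eq_of_sameLeaf s q m (Finset.mem_filter.1 hi).2 h]
          simp [leafCount, mul_comm]
      _ ≤ ∑ i, subsampleMean s q m z i :=
          Finset.sum_le_univ_sum_of_nonneg fun i => subsampleMean_nonneg s q m z i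
      _ ≤ 1 := sum_subsampleMean_le_one s q m z
  · simp [subsampleMean, structureVector_eq_zero s q _ h]

/-- A structure vector has mass 1 unless the subsample misses the leaf of `z`, in which case it is
0; the quotient of binomials is the probability of a miss. -/
lemma one_sub_le_sum_subsampleMean (hm : m ≤ n) (z : Cov d) :
    1 - ((n - leafCount s q z).choose m : ℝ) / n.choose m ≤ ∑ k, subsampleMean s q m z k := by
  classical
  have hpos : (0 : ℝ) < n.choose m := by exact_mod_cast Nat.choose_pos hm
  rw [sum_subsampleMean, ← Finset.mul_sum]
  simp only [sum_structureVector]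
  rw [Finset.sum_boole]
  have hsplit := Finset.card_filter_add_card_filter_not
    (s := Finset.powersetCard m (Finset.univ : Finset (Fin n)))
    (fun w => ∃ i ∈ w, q.SameLeaf z (s i).1)
  have hneg : Finset.filter (fun w => ¬ ∃ i ∈ w, q.SameLeaf z (s i).1)
      (Finset.powersetCard m (Finset.univ : Finset (Fin n))) =
      Finset.powersetCard m (Finset.filter (fun i => q.SameLeaf z (s i).1) Finset.univ)ᶜ := by
    ext w
    simp only [Finset.mem_filter, Finset.mem_powersetCard, true_and,
      Finset.subset_iff, Finset.mem_compl, Finset.mem_univ, not_exists, not_and]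
    tauto
  rw [hneg, Finset.card_powersetCard, Finset.card_powersetCard, Finset.card_compl,
    Finset.card_univ, Fintype.card_fin] at hsplit
  have hsplit' : ((Finset.filter (fun w => ∃ i ∈ w, q.SameLeaf z (s i).1)
      (Finset.powersetCard m (Finset.univ : Finset (Fin n)))).card : ℝ) +
      ((n - leafCount s q z).choose m : ℝ) = n.choose m := by
    exact_mod_cast hsplit
  rw [← hsplit'] at hpos ⊢
  field_simp
  linarith

/-- The probability that a uniform index set of size `m` misses `a` given indices. -/
lemma choose_sub_div_choose_le {n a m : ℕ} (ha : a ≤ n) (hm : m ≤ n) :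
    ((n - a).choose m : ℝ) / n.choose m ≤ Real.exp (-(m * a / n : ℝ)) := by
  rcases Nat.eq_zero_or_pos n with rfl | hn
  · obtain rfl : m = 0 := by omega
    simp
  have hn' : (0 : ℝ) < n := by exact_mod_cast hn
  -- From `k` to `k + 1` the quotient of the binomials gains the factor (n-a-k)/(n-k), which is at
  -- most 1 - a/n. When `n - a ≤ k` the truncated subtraction gives 0.
  have key : ∀ k, k ≤ n → ((n - a).choose k : ℝ) ≤ (1 - a / n : ℝ) ^ k * n.choose k := by
    have hbase : (0 : ℝ) ≤ 1 - a / n := by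
      rw [sub_nonneg, div_le_one hn']
      exact_mod_cast ha
    intro k
    induction k with
    | zero => simp
    | succ k ih =>
      intro hk
      have ih := ih (by omega)
      have h1 : ((n - a).choose (k + 1) : ℝ) * (k + 1) = (n - a).choose k * ((n - a - k : ℕ) : ℝ) := by
        exact_mod_cast Nat.choose_succ_right_eq (n - a) k
      have h2 : (n.choose (k + 1) : ℝ) * (k + 1) = n.choose k * ((n - k : ℕ) : ℝ) := by
        exact_mod_cast Nat.choose_succ_right_eq n k
      have h3 : ((n - a - k : ℕ) : ℝ) ≤ (1 - a / n) * ((n - k : ℕ) : ℝ) := by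
        rcases le_total (n - a) k with h | h
        · rw [Nat.sub_eq_zero_of_le h]
          simpa using mul_nonneg hbase (Nat.cast_nonneg (α := ℝ) (n - k))
        · rw [Nat.cast_sub h, Nat.cast_sub ha, Nat.cast_sub (by omega : k ≤ n)]
          have : (1 - (a : ℝ) / n) * (n - k) = n - a - k + a * k / n := by field_simp; ring
          rw [this]
          have : (0 : ℝ) ≤ a * k / n := by positivity
          linarith
      have hk1 : (0 : ℝ) < k + 1 := by positivity
      refine le_of_mul_le_mul_right ?_ hk1
      rw [h1, mul_assoc, h2, pow_succ]
      calc _ ≤ ((1 - a / n : ℝ) ^ k * n.choose k) * ((1 - a / n) * ((n - k : ℕ) : ℝ)) := by gcongr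
        _ = _ := by ring
  have hpos : (0 : ℝ) < n.choose m := by exact_mod_cast Nat.choose_pos hm
  rw [div_le_iff₀ hpos]
  refine (key m hm).trans ?_
  gcongr
  have h1 : (0 : ℝ) ≤ 1 - a / n := by
    rw [sub_nonneg, div_le_one hn']
    exact_mod_cast ha
  calc (1 - a / n : ℝ) ^ m ≤ (Real.exp (-(a / n : ℝ))) ^ m := by
        gcongr
        exact Real.one_sub_le_exp_neg _
    _ = Real.exp (-(m * a / n : ℝ)) := by
        rw [← Real.exp_nat_mul]
        congr 1
        ring

end StructureVector

/-! ### Size, mass and support of the expected structure vector -/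

section ExpectedStructureVector

variable {d n : ℕ} (s : Sample d n) {Q : Finset (TreeStructure d)} (law : PMF Q) (m : ℕ)

lemma sum_law_toReal : ∑ q, (law q).toReal = 1 := by
  rw [← ENNReal.toReal_sum fun q _ => law.apply_ne_top q]
  have := law.tsum_coe
  rw [tsum_fintype] at this
  rw [this, ENNReal.toReal_one]

lemma expectedStructureVector_eq (z : Cov d) (k : Fin n) :
    expectedStructureVector s law m z k = ∑ q, (law q).toReal * subsampleMean s q.1 m z k := by
  unfold expectedStructureVector subsampleMean
  simp only [Finset.mul_sum, mul_assoc]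

lemma expectedStructureVector_nonneg (z : Cov d) (k : Fin n) :
    0 ≤ expectedStructureVector s law m z k := by
  rw [expectedStructureVector_eq]
  exact Finset.sum_nonneg fun q _ =>
    mul_nonneg ENNReal.toReal_nonneg (subsampleMean_nonneg s q.1 m z k)

lemma sum_expectedStructureVector (z : Cov d) :
    ∑ k, expectedStructureVector s law m z k =
      ∑ q, (law q).toReal * ∑ k, subsampleMean s q.1 m z k := by
  simp only [expectedStructureVector_eq, Finset.mul_sum]
  rw [Finset.sum_comm]

lemma sum_expectedStructureVector_le_one (z : Cov d) :
    ∑ k, expectedStructureVector s law m z k ≤ 1 := by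
  rw [sum_expectedStructureVector, ← sum_law_toReal law]
  refine Finset.sum_le_sum fun q _ => ?_
  exact mul_le_of_le_one_right ENNReal.toReal_nonneg (sum_subsampleMean_le_one s q.1 m z)

lemma kernelMatrix_isSymm : (kernelMatrix s law m).IsSymm := by
  ext i j
  simp only [kernelMatrix, Matrix.transpose_apply, Matrix.of_apply, expectedStructureVector_eq]
  exact Finset.sum_congr rfl fun q _ => by rw [subsampleMean_symm]

lemma kernelMatrix_nonneg (i j : Fin n) : 0 ≤ kernelMatrix s law m i j :=
  expectedStructureVector_nonneg s law m _ _

lemma sum_kernelMatrix_le_one (i : Fin n) : ∑ j, kernelMatrix s law m i j ≤ 1 :=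
  sum_expectedStructureVector_le_one s law m _

variable {a D : ℝ} {z : Cov d}

lemma expectedStructureVector_le (ha : 0 < a) (hcount : ∀ q ∈ Q, a ≤ leafCount s q z) (k : Fin n) :
    expectedStructureVector s law m z k ≤ 1 / a := by
  rw [expectedStructureVector_eq]
  calc _ ≤ ∑ q, (law q).toReal * (1 / a) := by
        refine Finset.sum_le_sum fun q _ => mul_le_mul_of_nonneg_left ?_ ENNReal.toReal_nonneg
        rw [le_div_iff₀ ha]
        refine le_trans ?_ (subsampleMean_mul_leafCount_le_one s q.1 m z k)
        exact mul_le_mul_of_nonneg_left (hcount q.1 q.2) (subsampleMean_nonneg s q.1 m z k)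
    _ = 1 / a := by rw [← Finset.sum_mul, sum_law_toReal, one_mul]

lemma leafCount_le (q : TreeStructure d) (z : Cov d) : leafCount s q z ≤ n := by
  classical
  unfold leafCount
  exact (Finset.card_le_univ _).trans (by simp)

lemma one_sub_le_sum_expectedStructureVector (hm : m ≤ n)
    (hcount : ∀ q ∈ Q, a ≤ leafCount s q z) :
    1 - Real.exp (-(m * a / n : ℝ)) ≤ ∑ k, expectedStructureVector s law m z k := by
  rw [sum_expectedStructureVector]
  calc _ = ∑ q, (law q).toReal * (1 - Real.exp (-(m * a / n : ℝ))) := by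
        rw [← Finset.sum_mul, sum_law_toReal, one_mul]
    _ ≤ _ := by
        refine Finset.sum_le_sum fun q _ => mul_le_mul_of_nonneg_left ?_ ENNReal.toReal_nonneg
        refine le_trans ?_ (one_sub_le_sum_subsampleMean s q.1 m hm z)
        have h1 := choose_sub_div_choose_le (leafCount_le s q.1 z) hm
        have h2 : Real.exp (-(m * leafCount s q.1 z / n : ℝ)) ≤ Real.exp (-(m * a / n : ℝ)) := by
          gcongr
          exact hcount q.1 q.2
        linarith

lemma dist_le_of_expectedStructureVector_ne_zero
    (hdiam : ∀ q ∈ Q, ∀ A ∈ q.leaves, Metric.diam A ≤ D) {k : Fin n}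
    (h : expectedStructureVector s law m z k ≠ 0) : dist z (s k).1 ≤ D := by
  rw [expectedStructureVector_eq] at h
  obtain ⟨q, -, hq⟩ := Finset.exists_ne_zero_of_sum_ne_zero h
  have hsl : q.1.SameLeaf z (s k).1 := by
    by_contra hns
    apply hq
    simp [subsampleMean, structureVector_eq_zero s q.1 _ hns]
  obtain ⟨A, hA, hz, hk⟩ := hsl
  exact (Metric.dist_le_diam_of_mem (isBounded_unitCube.subset (q.1.leaf_subset hA)) hz hk).trans
    (hdiam q.1 q.2 A hA)

end ExpectedStructureVector

/-! ### Deterministic convergence of the iterates, given vanishing tree noise -/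

section Iterate

variable {d n : ℕ} {lam : ℝ} {M : ℝ≥0∞} {s : Sample d n} {tree : ℕ → TreeStructure d}
  {sub : ℕ → Finset (Fin n)}

lemma truncate_eq_self {u : ℝ} (h : ENNReal.ofReal |u| ≤ M) : truncate M u = u := by
  rw [truncate, min_eq_left h, ENNReal.toReal_ofReal (abs_nonneg u)]
  exact sign_mul_abs u

lemma ofReal_norm_response_le (hM : ∀ i, ENNReal.ofReal (|(s i).2| / (1 - lam)) ≤ M)
    (h1 : lam < 1) : ENNReal.ofReal (‖fun i => (s i).2‖ / (1 - lam)) ≤ M := by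
  rcases eq_or_ne M ⊤ with rfl | hM'
  · exact le_top
  have hpos : 0 < 1 - lam := by linarith
  rw [ENNReal.ofReal_le_iff_le_toReal hM', div_le_iff₀ hpos]
  refine (pi_norm_le_iff_of_nonneg (mul_nonneg ENNReal.toReal_nonneg hpos.le)).2 fun i => ?_
  have := (ENNReal.ofReal_le_iff_le_toReal hM').1 (hM i)
  rwa [div_le_iff₀ hpos] at this

lemma abs_sum_structureVector_mul_le (s : Sample d n) (q : TreeStructure d) (w : Finset (Fin n))
    (z : Cov d) {u : Fin n → ℝ} {B : ℝ} (hB : 0 ≤ B) (hu : ∀ k, |u k| ≤ B) :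
    |∑ k, structureVector s q w z k * u k| ≤ B := by
  calc |∑ k, structureVector s q w z k * u k|
      ≤ ∑ k, |structureVector s q w z k * u k| := Finset.abs_sum_le_sum_abs _ _
    _ ≤ ∑ k, structureVector s q w z k * B := by
        refine Finset.sum_le_sum fun k _ => ?_
        rw [abs_mul, abs_of_nonneg (structureVector_nonneg s q w z k)]
        exact mul_le_mul_of_nonneg_left (hu k) (structureVector_nonneg s q w z k)
    _ = (∑ k, structureVector s q w z k) * B := by rw [Finset.sum_mul]
    _ ≤ 1 * B := mul_le_mul_of_nonneg_right (sum_structureVector_le_one s q w z) hB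
    _ = B := one_mul B

/-- The iterates stay in the range where the truncation acts trivially. -/
lemma abs_iterate_le (h0 : 0 < lam) (h1 : lam < 1)
    (hM : ∀ i, ENNReal.ofReal (|(s i).2| / (1 - lam)) ≤ M) (b : ℕ) (z : Cov d) :
    |iterate lam M s tree sub b z| ≤ ‖fun i => (s i).2‖ / (1 - lam) := by
  have hpos : 0 < 1 - lam := by linarith
  set Y := ‖fun i => (s i).2‖ with hY
  have hY0 : 0 ≤ Y := norm_nonneg _
  have hMY := ofReal_norm_response_le hM h1
  induction b generalizing z with
  | zero => simpa [iterate] using div_nonneg hY0 hpos.le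
  | succ b ih =>
    have htr : ∀ u : ℝ, |u| ≤ Y / (1 - lam) → truncate M u = u := fun u hu =>
      truncate_eq_self ((ENNReal.ofReal_le_ofReal hu).trans hMY)
    have hb : (0 : ℝ) < b + 1 := by positivity
    simp only [iterate]
    have hsum := abs_sum_structureVector_mul_le s (tree b) (sub b) z
      (u := fun k => (s k).2 - truncate M (iterate lam M s tree sub b (s k).1))
      (B := Y + Y / (1 - lam)) (by positivity) (fun k => by
        rw [htr _ (ih _)]
        refine (abs_sub _ _).trans (add_le_add ?_ (ih _))
        exact norm_le_pi_norm (fun i => (s i).2) k)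
    -- After clearing 1 - λ this is λ(2-λ)Y ≤ Y, that is (1-λ)²Y ≥ 0: the bound Y/(1-λ) reproduces
    -- itself under the iteration.
    have hstep : lam * (Y + Y / (1 - lam)) ≤ Y / (1 - lam) := by
      rw [le_div_iff₀ hpos]
      have : lam * (Y + Y / (1 - lam)) * (1 - lam) = lam * (Y * (1 - lam) + Y) := by field_simp
      rw [this]
      nlinarith [mul_nonneg hY0 (sq_nonneg (1 - lam))]
    calc _ ≤ (b : ℝ) / (b + 1) * (Y / (1 - lam)) + lam / (b + 1) * (Y + Y / (1 - lam)) := by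
          refine (abs_add_le _ _).trans (add_le_add ?_ ?_)
          · rw [abs_mul, abs_of_nonneg (by positivity)]
            gcongr
            exact ih z
          · rw [abs_mul, abs_of_nonneg (by positivity)]
            gcongr
      _ = (b * (Y / (1 - lam)) + lam * (Y + Y / (1 - lam))) / (b + 1) := by ring
      _ ≤ (b * (Y / (1 - lam)) + Y / (1 - lam)) / (b + 1) := by gcongr
      _ = Y / (1 - lam) := by field_simp

lemma iterate_succ_eq (h0 : 0 < lam) (h1 : lam < 1)
    (hM : ∀ i, ENNReal.ofReal (|(s i).2| / (1 - lam)) ≤ M) (b : ℕ) (z : Cov d) :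
    iterate lam M s tree sub (b + 1) z = (b : ℝ) / (b + 1) * iterate lam M s tree sub b z +
        lam / (b + 1) * ∑ k, structureVector s (tree b) (sub b) z k *
          ((s k).2 - iterate lam M s tree sub b (s k).1) := by
  have h : ∀ k, truncate M (iterate lam M s tree sub b (s k).1) =
      iterate lam M s tree sub b (s k).1 := fun k =>
    truncate_eq_self ((ENNReal.ofReal_le_ofReal (abs_iterate_le h0 h1 hM b _)).trans
      (ofReal_norm_response_le hM h1))
  simp only [iterate, h]

/-- The step sizes 1/(b+1) make b·f̂_b telescope, so an iterate is λ times a plain average over the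
trees. -/
lemma mul_iterate_eq_sum (h0 : 0 < lam) (h1 : lam < 1)
    (hM : ∀ i, ENNReal.ofReal (|(s i).2| / (1 - lam)) ≤ M) (b : ℕ) (z : Cov d) :
    b * iterate lam M s tree sub b z =
      lam * ∑ j ∈ Finset.range b, ∑ k, structureVector s (tree j) (sub j) z k *
          ((s k).2 - iterate lam M s tree sub j (s k).1) := by
  induction b with
  | zero => simp
  | succ b ih =>
    rw [Finset.sum_range_succ, mul_add, ← ih, iterate_succ_eq h0 h1 hM]
    push_cast
    field_simp

/-- A bounded sequence dominated by a null sequence plus a fraction of its running averages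
tends to zero. -/
lemma tendsto_zero_of_le_average {g e : ℕ → ℝ} (hg : ∀ b, 0 ≤ g b) {B : ℝ} (hB : ∀ b, g b ≤ B)
    (he : Tendsto e atTop (𝓝 0)) (h1 : lam < 1) (h0 : 0 < lam)
    (h : ∀ᶠ b : ℕ in atTop, g b ≤ e b + lam * ((b : ℝ)⁻¹ * ∑ j ∈ Finset.range b, g j)) :
    Tendsto g atTop (𝓝 0) := by
  have hbdd : IsBoundedUnder (· ≤ ·) atTop g := isBoundedUnder_of ⟨B, hB⟩
  have hbdd' : IsBoundedUnder (· ≥ ·) atTop g := isBoundedUnder_of ⟨0, hg⟩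
  set l := limsup g atTop with hl
  have hl0 : 0 ≤ l := le_limsup_of_frequently_le (Frequently.of_forall hg) hbdd
  -- One `η` pays for `e b`, one for the head of the average (before `N`), and one for the excess of
  -- the tail over the limsup.
  have key : ∀ η > 0, l ≤ η + lam * (l + η + η) := by
    intro η hη
    refine limsup_le_of_le hbdd'.isCoboundedUnder_le ?_
    have h2 : ∀ᶠ b in atTop, g b < l + η := eventually_lt_of_limsup_lt (by linarith) hbdd
    obtain ⟨N, hN⟩ := eventually_atTop.1 h2
    have h3 : Tendsto (fun b : ℕ => (b : ℝ)⁻¹ * ∑ j ∈ Finset.range N, g j) atTop (𝓝 0) := by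
      simpa using tendsto_inv_atTop_nhds_zero_nat.mul_const (∑ j ∈ Finset.range N, g j)
    filter_upwards [h, he.eventually_lt_const hη, h3.eventually_lt_const hη,
      eventually_ge_atTop N, eventually_gt_atTop 0] with b hb1 hb2 hb3 hb4 hb5
    refine hb1.trans ?_
    have hb : (0 : ℝ) < b := by exact_mod_cast hb5
    have h4 : ∑ j ∈ Finset.range b, g j ≤ ∑ j ∈ Finset.range N, g j + b * (l + η) := by
      rw [← Finset.sum_range_add_sum_Ico _ hb4]
      gcongr
      calc ∑ j ∈ Finset.Ico N b, g j ≤ ∑ j ∈ Finset.Ico N b, (l + η) :=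
            Finset.sum_le_sum fun j hj => (hN j (Finset.mem_Ico.1 hj).1).le
        _ = ((b - N : ℕ) : ℝ) * (l + η) := by simp [mul_add]
        _ ≤ b * (l + η) := by
            gcongr
            omega
    have h5 : (b : ℝ)⁻¹ * ∑ j ∈ Finset.range b, g j ≤ η + (l + η) := by
      calc _ ≤ (b : ℝ)⁻¹ * (∑ j ∈ Finset.range N, g j + b * (l + η)) := by gcongr
        _ = (b : ℝ)⁻¹ * ∑ j ∈ Finset.range N, g j + (l + η) := by field_simp
        _ ≤ _ := by gcongr
    nlinarith
  have hl1 : l ≤ 0 := by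
    by_contra hcon
    push Not at hcon
    -- The inequality reads (1-λ)l ≤ (1+2λ)η, and (1+2λ)η ≤ 3η; this `η` makes the right side at
    -- most half of the left.
    have := key ((1 - lam) * l / 6) (by have := sub_pos.2 h1; positivity)
    nlinarith [mul_pos (sub_pos.2 h1) hcon]
  exact tendsto_of_le_liminf_of_limsup_le
    (le_liminf_of_le hbdd.isCoboundedUnder_ge (Eventually.of_forall hg)) hl1 hbdd hbdd'

/-- If the noise averages vanish, then the iterates converge to the kernel ridge prediction. -/
lemma tendsto_iterate (h0 : 0 < lam) (h1 : lam < 1)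
    (hM : ∀ i, ENNReal.ofReal (|(s i).2| / (1 - lam)) ≤ M)
    {Q : Finset (TreeStructure d)} (law : PMF Q) (m : ℕ) (x : Cov d)
    (hnoise : ∀ z, (z = x ∨ ∃ i, z = (s i).1) → Tendsto (fun b : ℕ => (b : ℝ)⁻¹ *
      ∑ j ∈ Finset.range b, ∑ k, (structureVector s (tree j) (sub j) z k -
        expectedStructureVector s law m z k) *
          ((s k).2 - iterate lam M s tree sub j (s k).1)) atTop (𝓝 0)) :
    Tendsto (fun b => iterate lam M s tree sub b x) atTop
      (𝓝 (∑ k, ridgeWeights lam s law m x k * (s k).2)) := by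
  set K := kernelMatrix s law m with hK
  set A := (1 / lam) • (1 : Matrix (Fin n) (Fin n) ℝ) + K with hA
  set y : Fin n → ℝ := fun k => (s k).2 with hy
  set u := A⁻¹.mulVec y with hu
  have hKnn := kernelMatrix_nonneg s law m
  have hKrow := sum_kernelMatrix_le_one s law m
  have hAu : ∀ i, 1 / lam * u i + K.mulVec u i = y i := by
    intro i
    have := congrFun (ridge_mulVec_inv_mulVec hKnn hKrow h0 h1 y) i
    rwa [ridge_mulVec_apply] at this
  -- the residual `y - F_b` tends to `u / lam`
  set R : ℕ → Fin n → ℝ := fun b k => y k - iterate lam M s tree sub b (s k).1 with hR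
  -- The average over the trees splits into noise around the expected structure vector and that
  -- vector applied to the averaged residuals.
  have hdecomp : ∀ z, ∀ b : ℕ, 0 < b → iterate lam M s tree sub b z =
      lam * ((b : ℝ)⁻¹ * ∑ j ∈ Finset.range b, ∑ k, (structureVector s (tree j) (sub j) z k -
        expectedStructureVector s law m z k) * R j k) +
      lam * ∑ k, expectedStructureVector s law m z k *
        ((b : ℝ)⁻¹ * ∑ j ∈ Finset.range b, R j k) := by
    intro z b hb
    have hb' : (b : ℝ) ≠ 0 := by exact_mod_cast hb.ne'
    have h2 := mul_iterate_eq_sum (tree := tree) (sub := sub) h0 h1 hM b z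
    have h3 : ∑ k, expectedStructureVector s law m z k *
        ((b : ℝ)⁻¹ * ∑ j ∈ Finset.range b, R j k) = (b : ℝ)⁻¹ *
        ∑ j ∈ Finset.range b, ∑ k, expectedStructureVector s law m z k * R j k := by
      rw [Finset.sum_comm, Finset.mul_sum]
      refine Finset.sum_congr rfl fun k _ => ?_
      rw [← Finset.mul_sum]
      ring
    rw [h3, ← mul_add, ← mul_add, ← Finset.sum_add_distrib]
    have h4 : ∀ j, (∑ k, (structureVector s (tree j) (sub j) z k -
        expectedStructureVector s law m z k) * R j k +
        ∑ k, expectedStructureVector s law m z k * R j k) =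
        ∑ k, structureVector s (tree j) (sub j) z k * R j k := by
      intro j
      rw [← Finset.sum_add_distrib]
      exact Finset.sum_congr rfl fun k _ => by ring
    simp only [h4]
    rw [mul_left_comm, ← h2, inv_mul_cancel_left₀ hb']
  set G : ℕ → Fin n → ℝ := fun b k => R b k - 1 / lam * u k with hG
  have hGavg : ∀ b : ℕ, 0 < b → ∀ k, (b : ℝ)⁻¹ * ∑ j ∈ Finset.range b, R j k =
      (b : ℝ)⁻¹ * ∑ j ∈ Finset.range b, G j k + 1 / lam * u k := by
    intro b hb k
    have hb' : (b : ℝ) ≠ 0 := by exact_mod_cast hb.ne'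
    simp only [hG, Finset.sum_sub_distrib, Finset.sum_const, Finset.card_range, nsmul_eq_mul]
    field_simp
    ring
  set e : ℕ → Fin n → ℝ := fun b i => (b : ℝ)⁻¹ * ∑ j ∈ Finset.range b,
    ∑ k, (structureVector s (tree j) (sub j) (s i).1 k -
        expectedStructureVector s law m (s i).1 k) * R j k with he
  have hetend : Tendsto e atTop (𝓝 0) := tendsto_pi_nhds.2 fun i => hnoise _ (Or.inr ⟨i, rfl⟩)
  -- Since u/λ + Ku = y, the vector u/λ is the stationary residual; subtracting it leaves a
  -- recursion driven by the noise alone.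
  have hGrec : ∀ b : ℕ, 0 < b → ∀ i, G b i = -(lam * e b i) -
      lam * K.mulVec (fun k => (b : ℝ)⁻¹ * ∑ j ∈ Finset.range b, G j k) i := by
    intro b hb i
    have h2 := hdecomp (s i).1 b hb
    have h3 : ∑ k, expectedStructureVector s law m (s i).1 k *
        ((b : ℝ)⁻¹ * ∑ j ∈ Finset.range b, R j k) =
        K.mulVec (fun k => (b : ℝ)⁻¹ * ∑ j ∈ Finset.range b, G j k) i + 1 / lam * K.mulVec u i := by
      simp only [hGavg b hb, Matrix.mulVec, dotProduct, Finset.mul_sum _ _ (1 / lam)]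
      rw [← Finset.sum_add_distrib]
      exact Finset.sum_congr rfl fun k _ => by
        simp only [hK, kernelMatrix, Matrix.of_apply]; ring
    rw [h3] at h2
    have h4 := hAu i
    have h5 : iterate lam M s tree sub b (s i).1 = lam * e b i +
        lam * K.mulVec (fun k => (b : ℝ)⁻¹ * ∑ j ∈ Finset.range b, G j k) i + K.mulVec u i := by
      rw [h2, mul_add, ← mul_assoc lam (1 / lam), mul_one_div_cancel h0.ne', one_mul, add_assoc]
    change y i - iterate lam M s tree sub b (s i).1 - 1 / lam * u i = _
    linarith
  have hGzero : Tendsto (fun b => ‖G b‖) atTop (𝓝 0) := by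
    have hpos : 0 < 1 - lam := by linarith
    refine tendsto_zero_of_le_average (e := fun b => lam * ‖e b‖)
      (B := ‖y‖ + ‖y‖ / (1 - lam) + ‖(1 / lam) • u‖) (fun b => norm_nonneg _) (fun b => ?_)
      ?_ h1 h0 ?_
    · refine (pi_norm_le_iff_of_nonneg (by positivity)).2 fun k => ?_
      refine (norm_sub_le _ _).trans (add_le_add ((norm_sub_le _ _).trans (add_le_add ?_ ?_)) ?_)
      · exact norm_le_pi_norm y k
      · exact abs_iterate_le h0 h1 hM b _
      · exact norm_le_pi_norm ((1 / lam) • u) k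
    · simpa using (hetend.norm).const_mul lam
    · filter_upwards [eventually_gt_atTop 0] with b hb
      have hb' : (0 : ℝ) < b := by exact_mod_cast hb
      have hSnn : 0 ≤ (b : ℝ)⁻¹ * ∑ j ∈ Finset.range b, ‖G j‖ :=
        mul_nonneg (by positivity) (Finset.sum_nonneg fun j _ => norm_nonneg _)
      refine (pi_norm_le_iff_of_nonneg (by positivity)).2 fun i => ?_
      rw [hGrec b hb i]
      refine (norm_sub_le _ _).trans (add_le_add ?_ ?_)
      · rw [norm_neg, norm_mul, Real.norm_of_nonneg h0.le]
        gcongr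
        exact norm_le_pi_norm (e b) i
      · rw [norm_mul, Real.norm_of_nonneg h0.le]
        gcongr
        refine abs_mulVec_le hKnn hKrow hSnn (fun k => ?_) i
        rw [abs_mul, abs_of_pos (by positivity)]
        gcongr
        refine (Finset.abs_sum_le_sum_abs _ _).trans (Finset.sum_le_sum fun j _ => ?_)
        exact norm_le_pi_norm (G j) k
  have hGk : ∀ k, Tendsto (fun b => R b k) atTop (𝓝 (1 / lam * u k)) := by
    intro k
    have h2 : Tendsto G atTop (𝓝 0) := tendsto_zero_iff_norm_tendsto_zero.2 hGzero
    have h3 := (tendsto_pi_nhds.1 h2 k).add_const (1 / lam * u k)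
    simpa [hG] using h3
  have hlim : Tendsto (fun b : ℕ => lam * ((b : ℝ)⁻¹ * ∑ j ∈ Finset.range b,
      ∑ k, (structureVector s (tree j) (sub j) x k -
        expectedStructureVector s law m x k) * R j k) +
      lam * ∑ k, expectedStructureVector s law m x k *
        ((b : ℝ)⁻¹ * ∑ j ∈ Finset.range b, R j k)) atTop
      (𝓝 (lam * 0 + lam * ∑ k, expectedStructureVector s law m x k * (1 / lam * u k))) := by
    refine ((hnoise x (Or.inl rfl)).const_mul lam).add (Tendsto.const_mul lam ?_)
    exact tendsto_finsetSum _ fun k _ => ((hGk k).cesaro).const_mul _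
  -- The residuals tend to u/λ, so the factors λ cancel and k·u remains, which is r·y after moving
  -- the inverse to the other side.
  have hval : lam * 0 + lam * ∑ k, expectedStructureVector s law m x k * (1 / lam * u k) =
      ∑ k, ridgeWeights lam s law m x k * (s k).2 := by
    have h2 : ∑ k, ridgeWeights lam s law m x k * (s k).2 =
        Matrix.vecMul (expectedStructureVector s law m x) A⁻¹ ⬝ᵥ y := rfl
    rw [h2, ← Matrix.dotProduct_mulVec, mul_zero, zero_add, Finset.mul_sum]
    refine Finset.sum_congr rfl fun k _ => ?_
    rw [← hu]
    field_simp
  rw [← hval]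
  refine hlim.congr' ?_
  filter_upwards [eventually_gt_atTop 0] with b hb
  exact (hdecomp x b hb).symm

end Iterate

/-! ### A strong law for bounded orthogonal variables -/

section StrongLaw

variable {Ω : Type*} [mΩ : MeasurableSpace Ω] {P : Measure Ω} [IsProbabilityMeasure P]

lemma integral_sum_sq_le {D : ℕ → Ω → ℝ} {C : ℝ} (hD : ∀ j, Measurable (D j))
    (hC : ∀ j ω, |D j ω| ≤ C) (horth : ∀ i j, i < j → ∫ ω, D i ω * D j ω ∂P = 0) (b : ℕ) :
    ∫ ω, (∑ j ∈ Finset.range b, D j ω) ^ 2 ∂P ≤ b * C ^ 2 := by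
  have hInt : ∀ i j, Integrable (fun ω => D i ω * D j ω) P := fun i j =>
    Integrable.of_bound ((hD i).mul (hD j)).aestronglyMeasurable (C * C)
      (Eventually.of_forall fun ω => by
        rw [norm_mul]
        exact mul_le_mul (hC i ω) (hC j ω) (norm_nonneg _) ((abs_nonneg _).trans (hC i ω)))
  have h1 : ∀ ω, (∑ j ∈ Finset.range b, D j ω) ^ 2 =
      ∑ i ∈ Finset.range b, ∑ j ∈ Finset.range b, D i ω * D j ω := fun ω => by
    rw [sq, Finset.sum_mul_sum]
  simp only [h1]
  rw [integral_finsetSum _ fun i _ => integrable_finsetSum _ fun j _ => hInt i j]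
  calc _ = ∑ i ∈ Finset.range b, ∫ ω, D i ω * D i ω ∂P := by
        refine Finset.sum_congr rfl fun i hi => ?_
        rw [integral_finsetSum _ fun j _ => hInt i j]
        refine Finset.sum_eq_single_of_mem i hi fun j _ hij => ?_
        rcases lt_or_gt_of_ne hij with h | h
        · simp only [mul_comm (D i _)]
          exact horth j i h
        · exact horth i j h
    _ ≤ ∑ i ∈ Finset.range b, C ^ 2 := by
        refine Finset.sum_le_sum fun i _ => ?_
        calc _ ≤ ∫ _, C ^ 2 ∂P := by
              refine integral_mono (hInt i i) (integrable_const _) fun ω => ?_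
              change D i ω * D i ω ≤ C ^ 2
              rw [← sq, ← sq_abs]
              exact pow_le_pow_left₀ (abs_nonneg _) (hC i ω) 2
          _ = C ^ 2 := by simp
    _ = b * C ^ 2 := by simp

/-- The strong law of large numbers for bounded orthogonal random variables. -/
lemma ae_tendsto_average_of_orthogonal {D : ℕ → Ω → ℝ} {C : ℝ} (hD : ∀ j, Measurable (D j))
    (hC : ∀ j ω, |D j ω| ≤ C) (horth : ∀ i j, i < j → ∫ ω, D i ω * D j ω ∂P = 0) :
    ∀ᵐ ω ∂P, Tendsto (fun b : ℕ => (b : ℝ)⁻¹ * ∑ j ∈ Finset.range b, D j ω) atTop (𝓝 0) := by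
  -- Along the squares the second moments of the averages are at most C²/(k+1)², which is summable;
  -- the shift keeps the denominators positive.
  set c : ℕ → ℕ := fun k => (k + 1) ^ 2 with hc
  set T : ℕ → Ω → ℝ := fun k ω => (∑ j ∈ Finset.range (c k), D j ω) / c k with hT
  have hTmeas : ∀ k, Measurable (T k) := fun k =>
    (Finset.measurable_sum _ fun j _ => hD j).div_const _
  have hSbound : ∀ b ω, |∑ j ∈ Finset.range b, D j ω| ≤ b * C := fun b ω =>
    (Finset.abs_sum_le_sum_abs _ _).trans
      ((Finset.sum_le_sum fun j _ => hC j ω).trans (by simp))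
  have hTint : ∀ k, ∫⁻ ω, ENNReal.ofReal (T k ω ^ 2) ∂P ≤
      ENNReal.ofReal (C ^ 2 * (1 / ((k + 1 : ℕ) : ℝ) ^ 2)) := by
    intro k
    have hck : (0 : ℝ) < c k := by simp only [hc]; positivity
    have hInt : Integrable (fun ω => T k ω ^ 2) P := by
      refine Integrable.of_bound ((hTmeas k).pow_const 2).aestronglyMeasurable (C ^ 2)
        (Eventually.of_forall fun ω => ?_)
      rw [norm_pow]
      refine pow_le_pow_left₀ (norm_nonneg _) ?_ 2
      rw [Real.norm_eq_abs, hT, abs_div, abs_of_pos hck, div_le_iff₀ hck, mul_comm C]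
      exact hSbound _ ω
    rw [← ofReal_integral_eq_lintegral_ofReal hInt (Eventually.of_forall fun ω => sq_nonneg _)]
    refine ENNReal.ofReal_le_ofReal ?_
    simp only [hT, div_pow]
    rw [integral_div, div_le_iff₀ (by positivity)]
    refine (integral_sum_sq_le hD hC horth (c k)).trans (le_of_eq ?_)
    simp only [hc]
    push_cast
    field_simp
  have hsum : ∑' k, ENNReal.ofReal (C ^ 2 * (1 / ((k + 1 : ℕ) : ℝ) ^ 2)) ≠ ⊤ := by
    refine Summable.tsum_ofReal_ne_top (Summable.mul_left _ ?_)
    exact (summable_nat_add_iff 1).2 (Real.summable_one_div_nat_pow.2 one_lt_two)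
  have hae : ∀ᵐ ω ∂P, ∑' k, ENNReal.ofReal (T k ω ^ 2) < ⊤ := by
    refine ae_lt_top (Measurable.tsum fun k => ((hTmeas k).pow_const 2).ennreal_ofReal) ?_
    rw [lintegral_tsum fun k => ((hTmeas k).pow_const 2).ennreal_ofReal.aemeasurable]
    exact ne_top_of_le_ne_top hsum (ENNReal.tsum_le_tsum hTint)
  filter_upwards [hae] with ω hω
  have h1 : Tendsto (fun k => T k ω ^ 2) atTop (𝓝 0) := by
    have h2 := ENNReal.tendsto_atTop_zero_of_tsum_ne_top hω.ne
    have h3 := (ENNReal.tendsto_toReal ENNReal.zero_ne_top).comp h2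
    refine h3.congr fun k => ?_
    simp [ENNReal.toReal_ofReal (sq_nonneg _)]
  have h2 : Tendsto (fun k => T k ω) atTop (𝓝 0) := by
    have h3 := h1.sqrt
    simp only [Real.sqrt_sq_eq_abs, Real.sqrt_zero] at h3
    exact tendsto_zero_iff_abs_tendsto_zero _ |>.2 h3
  -- adding the drift `C` makes the partial sums monotone
  have hmono : Monotone fun b : ℕ => ∑ j ∈ Finset.range b, (D j ω + C) := by
    refine monotone_nat_of_le_succ fun b => ?_
    rw [Finset.sum_range_succ]
    have := neg_le_of_abs_le (hC b ω)
    linarith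
  have hdrift : ∀ b : ℕ, 0 < b → (∑ j ∈ Finset.range b, (D j ω + C)) / (b : ℝ) =
      (∑ j ∈ Finset.range b, D j ω) / b + C := by
    intro b hb
    have hb' : (b : ℝ) ≠ 0 := by exact_mod_cast hb.ne'
    rw [Finset.sum_add_distrib]
    simp only [Finset.sum_const, Finset.card_range, nsmul_eq_mul]
    field_simp
  have h3 : Tendsto (fun b : ℕ => (∑ j ∈ Finset.range b, (D j ω + C)) / (b : ℝ)) atTop (𝓝 C) := by
    -- Consecutive squares have ratios tending to 1, so monotonicity carries convergence from the
    -- squares to all indices.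
    refine tendsto_div_of_monotone_of_exists_subseq_tendsto_div _ _ hmono fun a ha => ?_
    refine ⟨c, ?_, ?_, ?_⟩
    · have h4 : Tendsto (fun k : ℕ => (((k + 1 + 1 : ℕ) : ℝ) / ((k + 1 : ℕ) : ℝ)) ^ 2) atTop
          (𝓝 1) := by
        have h5 : Tendsto (fun k : ℕ => 1 + 1 / ((k : ℝ) + 1)) atTop (𝓝 (1 + 0)) :=
          tendsto_one_div_add_atTop_nhds_zero_nat.const_add 1
        have h6 := h5.pow 2
        rw [add_zero, one_pow] at h6
        refine h6.congr fun k => ?_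
        push_cast
        have : (k : ℝ) + 1 ≠ 0 := by positivity
        field_simp
      filter_upwards [h4.eventually_lt_const ha] with k hk
      rw [div_pow, div_lt_iff₀ (by positivity)] at hk
      simp only [hc]
      exact_mod_cast hk.le
    · refine tendsto_atTop_mono (fun k => ?_) tendsto_id
      simp only [hc, id]
      nlinarith
    · have h4 := h2.add_const C
      rw [zero_add] at h4
      refine h4.congr fun k => ?_
      exact (hdrift (c k) (by simp only [hc]; positivity)).symm
  have h4 := h3.sub_const C
  rw [sub_self] at h4
  refine h4.congr' ?_
  filter_upwards [eventually_gt_atTop 0] with b hb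
  rw [hdrift b hb, add_sub_cancel_right, div_eq_inv_mul]

end StrongLaw

/-! ### Conditional probabilities of events -/

section Conditioning

variable {Ω : Type*} {m₀ mΩ : MeasurableSpace Ω} {P : Measure Ω} [IsProbabilityMeasure P]

/-- An indicator minus its conditional probability is orthogonal to the conditioning. -/
lemma integral_indicator_sub_mul_eq_zero (hm : m₀ ≤ mΩ) {E : Set Ω}
    (hE : MeasurableSet E) {p g : Ω → ℝ} (hp : P[E.indicator (fun _ => (1 : ℝ)) | m₀] =ᵐ[P] p)
    (hg : Measurable[m₀] g) {C : ℝ} (hgC : ∀ ω, |g ω| ≤ C) :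
    ∫ ω, (E.indicator (fun _ => (1 : ℝ)) ω - p ω) * g ω ∂P = 0 := by
  have hi : Integrable (E.indicator (fun _ => (1 : ℝ))) P := (integrable_const 1).indicator hE
  have hgs : StronglyMeasurable[m₀] g := hg.stronglyMeasurable
  have hgm : AEStronglyMeasurable g P := (hgs.mono hm).aestronglyMeasurable
  have hb : ∀ᵐ ω ∂P, ‖g ω‖ ≤ C := Eventually.of_forall hgC
  have hig : Integrable (E.indicator (fun _ => (1 : ℝ)) * g) P := hi.mul_bdd hgm hb
  have hip : Integrable p P := integrable_condExp.congr hp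
  have hpg : Integrable (fun ω => p ω * g ω) P := hip.mul_bdd hgm hb
  have h1 : P[E.indicator (fun _ => (1 : ℝ)) * g | m₀] =ᵐ[P] fun ω => p ω * g ω := by
    refine (condExp_mul_of_stronglyMeasurable_right hgs hig hi).trans ?_
    filter_upwards [hp] with ω hω
    simp [hω]
  have h2 := integral_condExp hm (μ := P) (f := E.indicator (fun _ => (1 : ℝ)) * g)
  rw [integral_congr_ae h1] at h2
  simp only [sub_mul]
  have h3 := integral_sub hig hpg
  rw [h2, sub_self] at h3
  exact h3

/-- The conditional probability of an intersection, by the tower property. -/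
lemma condExp_indicator_inter {m₀ m₁ mΩ : MeasurableSpace Ω} {P : Measure Ω}
    [IsProbabilityMeasure P] (h01 : m₀ ≤ m₁) (h1 : m₁ ≤ mΩ) {E F : Set Ω}
    (hE : MeasurableSet[m₁] E) (hF : MeasurableSet F) {c : ℝ} {p : Ω → ℝ}
    (hFc : P[F.indicator (fun _ => (1 : ℝ)) | m₁] =ᵐ[P] fun _ => c)
    (hEp : P[E.indicator (fun _ => (1 : ℝ)) | m₀] =ᵐ[P] p) :
    P[(E ∩ F).indicator (fun _ => (1 : ℝ)) | m₀] =ᵐ[P] fun ω => c * p ω := by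
  have hmul : (E ∩ F).indicator (fun _ => (1 : ℝ)) =
      E.indicator (fun _ => (1 : ℝ)) * F.indicator (fun _ => (1 : ℝ)) := by
    funext ω
    by_cases hωE : ω ∈ E <;> by_cases hωF : ω ∈ F <;> simp [hωE, hωF]
  have hFint : Integrable (F.indicator (fun _ => (1 : ℝ))) P := (integrable_const 1).indicator hF
  have hEFint : Integrable (E.indicator (fun _ => (1 : ℝ)) * F.indicator (fun _ => (1 : ℝ))) P := by
    rw [← hmul]
    exact (integrable_const 1).indicator ((h1 _ hE).inter hF)
  have h2 : P[(E ∩ F).indicator (fun _ => (1 : ℝ)) | m₁] =ᵐ[P]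
      c • E.indicator (fun _ => (1 : ℝ)) := by
    rw [hmul]
    refine (condExp_mul_of_stronglyMeasurable_left
      (StronglyMeasurable.indicator (@stronglyMeasurable_const _ _ m₁ _ _) hE)
      hEFint hFint).trans ?_
    filter_upwards [hFc] with ω hω
    rw [Pi.mul_apply, hω, Pi.smul_apply, smul_eq_mul, mul_comm]
  calc P[(E ∩ F).indicator (fun _ => (1 : ℝ)) | m₀]
      =ᵐ[P] P[P[(E ∩ F).indicator (fun _ => (1 : ℝ)) | m₁] | m₀] :=
        (condExp_condExp_of_le h01 h1).symm
    _ =ᵐ[P] P[c • E.indicator (fun _ => (1 : ℝ)) | m₀] := condExp_congr_ae h2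
    _ =ᵐ[P] c • P[E.indicator (fun _ => (1 : ℝ)) | m₀] := condExp_smul c _ m₀
    _ =ᵐ[P] fun ω => c * p ω := by
        filter_upwards [hEp] with ω hω
        rw [Pi.smul_apply, hω, smul_eq_mul]

end Conditioning

/-! ### Measurability in the sample and the point -/

section Measurability

variable {d n : ℕ}

lemma IsHyperrectangle.measurableSet {A : Set (Cov d)} (hA : IsHyperrectangle A) :
    MeasurableSet A := by
  obtain ⟨I, hI, rfl⟩ := hA
  have h : {x : Cov d | ∀ j, x j ∈ I j} = ⋂ j, (fun x : Cov d => x j) ⁻¹' I j := by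
    ext x; simp
  rw [h]
  exact MeasurableSet.iInter fun j =>
    (by fun_prop : Measurable fun x : Cov d => x j) (hI j).measurableSet

lemma measurableSet_sameLeaf (q : TreeStructure d) :
    MeasurableSet {p : Cov d × Cov d | q.SameLeaf p.1 p.2} := by
  have h : {p : Cov d × Cov d | q.SameLeaf p.1 p.2} = ⋃ A ∈ q.leaves, A ×ˢ A := by
    ext p
    simp only [TreeStructure.SameLeaf, Set.mem_ofPred_eq, Set.mem_iUnion, Set.mem_prod, exists_prop]
  rw [h]
  exact Finset.measurableSet_biUnion _ fun A hA =>
    (q.hyperrectangle A hA).measurableSet.prod (q.hyperrectangle A hA).measurableSet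

lemma measurable_structureVector (q : TreeStructure d) (w : Finset (Fin n)) (k : Fin n) :
    Measurable fun p : Sample d n × Cov d => structureVector p.1 q w p.2 k := by
  classical
  have hset : ∀ i : Fin n,
      MeasurableSet {p : Sample d n × Cov d | q.SameLeaf p.2 (p.1 i).1 ∧ i ∈ w} := by
    intro i
    have h : Measurable fun p : Sample d n × Cov d => (p.2, (p.1 i).1) := by fun_prop
    exact (h (measurableSet_sameLeaf q)).inter (MeasurableSet.const _)
  have h1 : ∀ i : Fin n, Measurable fun p : Sample d n × Cov d =>
      if q.SameLeaf p.2 (p.1 i).1 ∧ i ∈ w then (1 : ℝ) else 0 := fun i =>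
    Measurable.ite (hset i) measurable_const measurable_const
  have h2 : ∀ p : Sample d n × Cov d, structureVector p.1 q w p.2 k =
      (if q.SameLeaf p.2 (p.1 k).1 ∧ k ∈ w then (1 : ℝ) else 0) /
        ∑ i, if q.SameLeaf p.2 (p.1 i).1 ∧ i ∈ w then (1 : ℝ) else 0 := by
    intro p
    rw [Finset.sum_boole]
    unfold structureVector
    congr!
  simp only [h2]
  exact (h1 k).div (Finset.measurable_sum _ fun i _ => h1 i)

lemma measurable_expectedStructureVector {Q : Finset (TreeStructure d)}
    {law : Sample d n → PMF Q} (hlaw : ∀ q, Measurable fun s => law s q) (m : ℕ) (k : Fin n)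
    {Z : Sample d n → Cov d} (hZ : Measurable Z) :
    Measurable fun s => expectedStructureVector s (law s) m (Z s) k := by
  unfold expectedStructureVector
  refine Finset.measurable_sum _ fun q _ => Finset.measurable_sum _ fun w _ => ?_
  exact ((hlaw q).ennreal_toReal.mul_const _).mul
    ((measurable_structureVector q.1 w k).comp (measurable_id.prodMk hZ))

/-- Handles random trees and subsamples through their level sets, without a σ-algebra on their value
spaces. -/
lemma measurable_apply_of_finite {Ω β E : Type*} {mΩ : MeasurableSpace Ω} [MeasurableSpace E]
    [Finite β] {t : Ω → β} (ht : ∀ b, MeasurableSet {ω | t ω = b}) {F : β → Ω → E}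
    (hF : ∀ b, Measurable (F b)) : Measurable fun ω => F (t ω) ω := by
  intro U hU
  have h : (fun ω => F (t ω) ω) ⁻¹' U = ⋃ b, {ω | t ω = b} ∩ F b ⁻¹' U := by
    ext ω; simp
  rw [h]
  exact MeasurableSet.iUnion fun b => (ht b).inter (hF b hU)

end Measurability

/-! ### Tree noise given the history, and almost sure convergence -/

section History

variable {Ω : Type*} {d n : ℕ}
  {Q : Finset (TreeStructure d)} {S : Ω → Sample d n} {tree : ℕ → Ω → Q}
  {sub : ℕ → Ω → Finset (Fin n)}

lemma measurable_history_sample (b : ℕ) : Measurable[history S tree sub b] S :=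
  Measurable.mono (comap_measurable S) le_sup_left le_rfl

lemma measurableSet_history_tree {j b : ℕ} (hj : j < b) (q : Q) :
    MeasurableSet[history S tree sub b] {ω | tree j ω = q} := by
  refine (le_sup_of_le_right (le_iSup₂_of_le j (Finset.mem_range.2 hj) le_sup_left) :
    MeasurableSpace.comap (tree j) ⊤ ≤ history S tree sub b) _ ?_
  exact ⟨{q}, trivial, rfl⟩

lemma measurableSet_history_sub {j b : ℕ} (hj : j < b) (w : Finset (Fin n)) :
    MeasurableSet[history S tree sub b] {ω | sub j ω = w} := by
  refine (le_sup_of_le_right (le_iSup₂_of_le j (Finset.mem_range.2 hj) le_sup_right) :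
    MeasurableSpace.comap (sub j) ⊤ ≤ history S tree sub b) _ ?_
  exact ⟨{w}, trivial, rfl⟩

variable {lam : ℝ} {M : Sample d n → ℝ≥0∞}

/-- Iterate `b` uses only the first `b` trees, so it is predictable: the residuals that a tree is
fitted to are known before the tree is drawn. The point may be random because the recursion
evaluates iterates at the sample points. -/
lemma measurable_iterate (h0 : 0 < lam) (h1 : lam < 1)
    (hM : ∀ s i, ENNReal.ofReal (|(s i).2| / (1 - lam)) ≤ M s) {b b' : ℕ} (hb : b ≤ b')
    {Z : Ω → Cov d} (hZ : Measurable[history S tree sub b'] Z) :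
    Measurable[history S tree sub b'] fun ω => iterate lam (M (S ω)) (S ω)
      (fun j => (tree j ω).1) (fun j => sub j ω) b (Z ω) := by
  let _ : MeasurableSpace Ω := history S tree sub b'
  have hS : Measurable S := measurable_history_sample b'
  induction b generalizing Z with
  | zero => exact measurable_const
  | succ b ih =>
    simp only [iterate_succ_eq h0 h1 (hM _)]
    refine ((ih (by omega) hZ).const_mul _).add (Measurable.const_mul ?_ _)
    refine Finset.measurable_sum _ fun k _ => Measurable.mul ?_ (Measurable.sub (by fun_prop) ?_)
    · refine measurable_apply_of_finite (t := tree b)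
        (F := fun q ω => structureVector (S ω) q.1 (sub b ω) (Z ω) k)
        (fun q => measurableSet_history_tree (by omega) q) fun q => ?_
      refine measurable_apply_of_finite (t := sub b)
        (F := fun w ω => structureVector (S ω) q.1 w (Z ω) k)
        (fun w => measurableSet_history_sub (by omega) w) fun w => ?_
      exact (measurable_structureVector q.1 w k).comp (hS.prodMk hZ)
    · exact ih (by omega) (by fun_prop)

/-- The probability of the tree structure `q` with the subsample `w`, given the sample. -/
noncomputable def treeProb (law : PMF Q) (m : ℕ) (q : Q) (w : Finset (Fin n)) : ℝ :=
  (if w.card = m then 1 / (n.choose m : ℝ) else 0) * (law q).toReal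

lemma treeProb_nonneg (law : PMF Q) (m : ℕ) (q : Q) (w : Finset (Fin n)) :
    0 ≤ treeProb law m q w := by
  unfold treeProb
  split_ifs <;> positivity

lemma treeProb_le_one (law : PMF Q) (m : ℕ) (q : Q) (w : Finset (Fin n)) :
    treeProb law m q w ≤ 1 := by
  have h1 : (law q).toReal ≤ 1 := by
    rw [← ENNReal.toReal_one]
    exact ENNReal.toReal_mono ENNReal.one_ne_top (law.coe_le_one q)
  have h2 : (if w.card = m then 1 / (n.choose m : ℝ) else 0) ≤ 1 := by
    split_ifs
    · rw [one_div]
      exact Nat.cast_inv_le_one _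
    · exact zero_le_one
  exact mul_le_one₀ h2 ENNReal.toReal_nonneg h1

lemma expectedStructureVector_eq_sum_treeProb (s : Sample d n) (law : PMF Q) (m : ℕ) (z : Cov d)
    (k : Fin n) : expectedStructureVector s law m z k =
      ∑ q : Q, ∑ w, treeProb law m q w * structureVector s q.1 w z k := by
  unfold expectedStructureVector
  refine Finset.sum_congr rfl fun q _ => ?_
  have : Finset.powersetCard m (Finset.univ : Finset (Fin n)) =
      Finset.filter (fun w => w.card = m) Finset.univ := by
    ext w; simp
  rw [this, Finset.sum_filter]
  refine Finset.sum_congr rfl fun w _ => ?_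
  unfold treeProb
  split_ifs <;> ring

variable [mΩ : MeasurableSpace Ω]

lemma comap_le_of_finite {β : Type*} [Finite β] {t : Ω → β}
    (ht : ∀ b, MeasurableSet {ω | t ω = b}) : MeasurableSpace.comap t ⊤ ≤ mΩ := by
  rintro _ ⟨U, -, rfl⟩
  have h : t ⁻¹' U = ⋃ b ∈ U, {ω | t ω = b} := by
    ext ω; simp
  rw [h]
  exact MeasurableSet.biUnion (Set.to_countable U) fun b _ => ht b

lemma history_le (hS : Measurable S) (htree : ∀ b q, MeasurableSet {ω | tree b ω = q})
    (hsub : ∀ b w, MeasurableSet {ω | sub b ω = w}) (b : ℕ) : history S tree sub b ≤ mΩ :=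
  sup_le hS.comap_le (iSup₂_le fun j _ =>
    sup_le (comap_le_of_finite (htree j)) (comap_le_of_finite (hsub j)))

variable {P : Measure Ω} [IsProbabilityMeasure P]

/-- Condition first on the new tree structure as well, where the subsample is uniform, and then on
the history alone. -/
lemma condExp_tree_sub {law : Sample d n → PMF Q} {m : ℕ} (hS : Measurable S)
    (htree : ∀ b q, MeasurableSet {ω | tree b ω = q})
    (hsub : ∀ b w, MeasurableSet {ω | sub b ω = w})
    (hna : NonAdaptive P law S tree sub) (hunif : UniformSubsampling P m S tree sub)
    (b : ℕ) (q : Q) (w : Finset (Fin n)) :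
    P[({ω | tree b ω = q} ∩ {ω | sub b ω = w}).indicator (fun _ => (1 : ℝ)) |
      history S tree sub b] =ᵐ[P] fun ω => treeProb (law (S ω)) m q w := by
  exact condExp_indicator_inter le_sup_left
    (sup_le (history_le hS htree hsub b) (comap_le_of_finite (htree b)))
    ((le_sup_right : MeasurableSpace.comap (tree b) ⊤ ≤ _) _ ⟨{q}, trivial, rfl⟩) (hsub b w)
    (hunif b w) (hna b q)

/-- The average noise of the trees vanishes almost surely. -/
lemma ae_tendsto_noise {law : Sample d n → PMF Q} {m : ℕ} (hS : Measurable S)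
    (hlaw : ∀ q, Measurable fun s => law s q)
    (htree : ∀ b q, MeasurableSet {ω | tree b ω = q})
    (hsub : ∀ b w, MeasurableSet {ω | sub b ω = w})
    (hna : NonAdaptive P law S tree sub) (hunif : UniformSubsampling P m S tree sub)
    (h0 : 0 < lam) (h1 : lam < 1)
    (hM : ∀ s i, ENNReal.ofReal (|(s i).2| / (1 - lam)) ≤ M s)
    {Z : Sample d n → Cov d} (hZ : Measurable Z) :
    ∀ᵐ ω ∂P, Tendsto (fun b : ℕ => (b : ℝ)⁻¹ * ∑ j ∈ Finset.range b,
      ∑ k, (structureVector (S ω) (tree j ω).1 (sub j ω) (Z (S ω)) k -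
        expectedStructureVector (S ω) (law (S ω)) m (Z (S ω)) k) *
          ((S ω k).2 - iterate lam (M (S ω)) (S ω) (fun j => (tree j ω).1) (fun j => sub j ω) j
            (S ω k).1)) atTop (𝓝 0) := by
  classical
  have hpos : 0 < 1 - lam := by linarith
  -- The responses may be unbounded, so the increments are divided by `1 + Y`, which the sample
  -- determines; the factor is restored pathwise at the end.
  set Y : Ω → ℝ := fun ω => ‖fun k => (S ω k).2‖ with hY
  set h : Q → Finset (Fin n) → ℕ → Ω → ℝ := fun q w j ω =>
    ∑ k, structureVector (S ω) q.1 w (Z (S ω)) k *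
      ((S ω k).2 - iterate lam (M (S ω)) (S ω) (fun j => (tree j ω).1) (fun j => sub j ω) j
            (S ω k).1) with hh
  set C : ℝ := 1 + 1 / (1 - lam) with hC
  have hC0 : 0 < C := by positivity
  have hhbound : ∀ q w j ω, |h q w j ω / (1 + Y ω)| ≤ C := by
    intro q w j ω
    have hY0 : 0 ≤ Y ω := norm_nonneg _
    rw [abs_div, abs_of_pos (by positivity : 0 < 1 + Y ω), div_le_iff₀ (by positivity)]
    calc |h q w j ω| ≤ Y ω + Y ω / (1 - lam) := by
          refine abs_sum_structureVector_mul_le _ _ _ _ (by positivity) fun k => ?_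
          refine (abs_sub _ _).trans (add_le_add ?_ (abs_iterate_le h0 h1 (hM _) j _))
          exact norm_le_pi_norm (fun i => (S ω i).2) k
      _ = C * Y ω := by rw [hC]; ring
      _ ≤ C * (1 + Y ω) := by gcongr; linarith
  have hhmeas : ∀ q w j b, j ≤ b →
      Measurable[history S tree sub b] fun ω => h q w j ω / (1 + Y ω) := by
    intro q w j b hjb
    let _ : MeasurableSpace Ω := history S tree sub b
    have hSb : Measurable S := measurable_history_sample b
    refine Measurable.div (Finset.measurable_sum _ fun k _ => Measurable.mul ?_
      (Measurable.sub (by fun_prop) ?_)) ?_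
    · exact (measurable_structureVector q.1 w k).comp (hSb.prodMk (hZ.comp hSb))
    · exact measurable_iterate h0 h1 hM hjb (by fun_prop)
    · refine measurable_const.add (Measurable.norm ?_)
      exact measurable_pi_lambda _ fun k => by fun_prop
  -- For each of the finitely many pairs (q, w): the indicator that it is drawn, centred by its
  -- conditional probability, times the contribution it would make. Summed over the pairs these give
  -- the tree noise.
  set D : Q → Finset (Fin n) → ℕ → Ω → ℝ := fun q w j ω =>
    (({ω | tree j ω = q} ∩ {ω | sub j ω = w}).indicator (fun _ => (1 : ℝ)) ω -
      treeProb (law (S ω)) m q w) * (h q w j ω / (1 + Y ω)) with hD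
  have hfac : ∀ q w j ω, |({ω | tree j ω = q} ∩ {ω | sub j ω = w}).indicator
      (fun _ => (1 : ℝ)) ω - treeProb (law (S ω)) m q w| ≤ 1 := by
    intro q w j ω
    have h2 := treeProb_nonneg (law (S ω)) m q w
    have h3 := treeProb_le_one (law (S ω)) m q w
    rw [abs_le]
    by_cases hω : ω ∈ {ω | tree j ω = q} ∩ {ω | sub j ω = w}
    · rw [Set.indicator_of_mem hω]; constructor <;> linarith
    · rw [Set.indicator_of_notMem hω]; constructor <;> linarith
  have hDbound : ∀ q w j ω, |D q w j ω| ≤ C := by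
    intro q w j ω
    rw [hD, abs_mul]
    calc _ ≤ 1 * C := mul_le_mul (hfac q w j ω) (hhbound q w j ω) (abs_nonneg _) zero_le_one
      _ = C := one_mul C
  have hDmeas : ∀ q w j b, j < b → Measurable[history S tree sub b] (D q w j) := by
    intro q w j b hjb
    let _ : MeasurableSpace Ω := history S tree sub b
    have hSb : Measurable S := measurable_history_sample b
    refine Measurable.mul (Measurable.sub ?_ ?_) (hhmeas q w j b hjb.le)
    · exact measurable_const.indicator
        ((measurableSet_history_tree hjb q).inter (measurableSet_history_sub hjb w))
    · exact (((hlaw q).comp hSb).ennreal_toReal).const_mul _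
  have hslln : ∀ q w, ∀ᵐ ω ∂P, Tendsto
      (fun b : ℕ => (b : ℝ)⁻¹ * ∑ j ∈ Finset.range b, D q w j ω) atTop (𝓝 0) := by
    intro q w
    refine ae_tendsto_average_of_orthogonal (C := C)
      (fun j => (hDmeas q w j (j + 1) (by omega)).mono (history_le hS htree hsub _) le_rfl)
      (fun j ω => hDbound q w j ω) fun i j hij => ?_
    -- In the product of increments `i < j`, everything but the centred indicator of step `j` is
    -- measurable for the history at `j`.
    have h2 := integral_indicator_sub_mul_eq_zero (history_le hS htree hsub j)
      ((htree j q).inter (hsub j w)) (condExp_tree_sub hS htree hsub hna hunif j q w)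
      (g := fun ω => D q w i ω * (h q w j ω / (1 + Y ω))) (C := C * C)
      ((hDmeas q w i j hij).mul (hhmeas q w j j le_rfl)) (fun ω => by
        rw [abs_mul]
        exact mul_le_mul (hDbound q w i ω) (hhbound q w j ω) (abs_nonneg _) hC0.le)
    rw [← h2]
    refine integral_congr_ae (Eventually.of_forall fun ω => ?_)
    simp only [hD]
    ring
  have hall : ∀ᵐ ω ∂P, ∀ q w, Tendsto
      (fun b : ℕ => (b : ℝ)⁻¹ * ∑ j ∈ Finset.range b, D q w j ω) atTop (𝓝 0) :=
    ae_all_iff.2 fun q => ae_all_iff.2 fun w => hslln q w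
  filter_upwards [hall] with ω hω
  have hY1 : 1 + Y ω ≠ 0 := by
    have : 0 ≤ Y ω := norm_nonneg _
    positivity
  have hlim : Tendsto (fun b : ℕ => (1 + Y ω) * ∑ q, ∑ w,
      ((b : ℝ)⁻¹ * ∑ j ∈ Finset.range b, D q w j ω)) atTop (𝓝 0) := by
    have h2 := (tendsto_finsetSum Finset.univ fun q _ =>
      tendsto_finsetSum Finset.univ fun w _ => hω q w).const_mul (1 + Y ω)
    simpa using h2
  refine hlim.congr fun b => ?_
  have hterm : ∀ j, ∑ k, (structureVector (S ω) (tree j ω).1 (sub j ω) (Z (S ω)) k -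
        expectedStructureVector (S ω) (law (S ω)) m (Z (S ω)) k) *
          ((S ω k).2 - iterate lam (M (S ω)) (S ω) (fun j => (tree j ω).1) (fun j => sub j ω) j
            (S ω k).1) = (1 + Y ω) * ∑ q, ∑ w, D q w j ω := by
    intro j
    have h2 : (1 + Y ω) * ∑ q, ∑ w, D q w j ω = ∑ q, ∑ w,
        (({ω | tree j ω = q} ∩ {ω | sub j ω = w}).indicator (fun _ => (1 : ℝ)) ω * h q w j ω -
          treeProb (law (S ω)) m q w * h q w j ω) := by
      simp only [Finset.mul_sum]
      refine Finset.sum_congr rfl fun q _ => Finset.sum_congr rfl fun w _ => ?_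
      simp only [hD]
      field_simp
    have h3 : ∑ q, ∑ w, ({ω | tree j ω = q} ∩ {ω | sub j ω = w}).indicator
        (fun _ => (1 : ℝ)) ω * h q w j ω = h (tree j ω) (sub j ω) j ω := by
      rw [Finset.sum_eq_single (tree j ω), Finset.sum_eq_single (sub j ω)]
      · simp
      · intro w _ hw
        rw [Set.indicator_of_notMem fun hmem => hw hmem.2.symm, zero_mul]
      · simp
      · intro q _ hq
        refine Finset.sum_eq_zero fun w _ => ?_
        rw [Set.indicator_of_notMem fun hmem => hq hmem.1.symm, zero_mul]
      · simp
    have h4 : ∑ q, ∑ w, treeProb (law (S ω)) m q w * h q w j ω =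
        ∑ k, expectedStructureVector (S ω) (law (S ω)) m (Z (S ω)) k *
          ((S ω k).2 - iterate lam (M (S ω)) (S ω) (fun j => (tree j ω).1) (fun j => sub j ω) j
            (S ω k).1) := by
      simp only [expectedStructureVector_eq_sum_treeProb, hh, Finset.sum_mul, Finset.mul_sum]
      rw [Finset.sum_comm' (t' := Finset.univ) (s' := fun _ => Finset.univ) (by simp)]
      simp only [Finset.sum_comm (s := (Finset.univ : Finset (Fin n)))]
      rw [Finset.sum_comm]
      refine Finset.sum_congr rfl fun q _ => ?_
      refine Finset.sum_congr rfl fun w _ => Finset.sum_congr rfl fun k _ => by ring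
    rw [h2]
    simp only [Finset.sum_sub_distrib]
    rw [h3, h4, ← Finset.sum_sub_distrib]
    exact Finset.sum_congr rfl fun k _ => by ring
  simp only [hterm]
  rw [← Finset.mul_sum, ← mul_assoc, mul_comm (b : ℝ)⁻¹, mul_assoc]
  congr 1
  rw [Finset.sum_comm (s := Finset.range b), Finset.mul_sum]
  refine Finset.sum_congr rfl fun q _ => ?_
  rw [Finset.sum_comm (s := Finset.range b), Finset.mul_sum]

/-- The Boulevard iterates converge almost surely to the kernel ridge prediction. -/
theorem ae_tendsto_iterate {law : Sample d n → PMF Q} {m : ℕ} (hS : Measurable S)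
    (hlaw : ∀ q, Measurable fun s => law s q)
    (htree : ∀ b q, MeasurableSet {ω | tree b ω = q})
    (hsub : ∀ b w, MeasurableSet {ω | sub b ω = w})
    (hna : NonAdaptive P law S tree sub) (hunif : UniformSubsampling P m S tree sub)
    (h0 : 0 < lam) (h1 : lam < 1)
    (hM : ∀ s i, ENNReal.ofReal (|(s i).2| / (1 - lam)) ≤ M s) (x : Cov d) :
    ∀ᵐ ω ∂P, Tendsto (fun b => iterate lam (M (S ω)) (S ω) (fun j => (tree j ω).1)
      (fun j => sub j ω) b x) atTop
      (𝓝 (∑ k, ridgeWeights lam (S ω) (law (S ω)) m x k * (S ω k).2)) := by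
  have hx := ae_tendsto_noise hS hlaw htree hsub hna hunif h0 h1 hM
    (Z := fun _ => x) measurable_const
  have hi : ∀ᵐ ω ∂P, ∀ i : Fin n, _ := ae_all_iff.2 fun i =>
    ae_tendsto_noise hS hlaw htree hsub hna hunif h0 h1 hM
      (Z := fun s => (s i).1) (by fun_prop)
  filter_upwards [hx, hi] with ω hωx hωi
  refine tendsto_iterate h0 h1 (hM _) (law (S ω)) m x fun z hz => ?_
  rcases hz with rfl | ⟨i, rfl⟩
  · exact hωx
  · exact hωi i

end History

/-! ### Central limit theorem with random weights -/

section CentralLimit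

/-- Telescoping: exchange one factor at a time, the others having norm at most 1. -/
lemma norm_prod_sub_prod_le {ι : Type*} (s : Finset ι) {z w : ι → ℂ} (hz : ∀ i ∈ s, ‖z i‖ ≤ 1)
    (hw : ∀ i ∈ s, ‖w i‖ ≤ 1) : ‖∏ i ∈ s, z i - ∏ i ∈ s, w i‖ ≤ ∑ i ∈ s, ‖z i - w i‖ := by
  classical
  induction s using Finset.induction_on with
  | empty => simp
  | insert i s hi ih =>
    rw [Finset.prod_insert hi, Finset.prod_insert hi, Finset.sum_insert hi]
    have ih := ih (fun j hj => hz j (Finset.mem_insert_of_mem hj))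
      (fun j hj => hw j (Finset.mem_insert_of_mem hj))
    have hprod : ‖∏ j ∈ s, z j‖ ≤ 1 := by
      rw [norm_prod]
      exact Finset.prod_le_one (fun j _ => norm_nonneg _)
        fun j hj => hz j (Finset.mem_insert_of_mem hj)
    have hwi : ‖w i‖ ≤ 1 := hw i (Finset.mem_insert_self i s)
    have heq : z i * ∏ j ∈ s, z j - w i * ∏ j ∈ s, w j =
        (z i - w i) * ∏ j ∈ s, z j + w i * (∏ j ∈ s, z j - ∏ j ∈ s, w j) := by ring
    rw [heq]
    refine (norm_add_le _ _).trans (add_le_add ?_ ?_)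
    · rw [norm_mul]
      exact mul_le_of_le_one_right (norm_nonneg _) hprod
    · rw [norm_mul]
      exact (mul_le_of_le_one_left (norm_nonneg _) hwi).trans ih

lemma charFun_sub_isLittleO {Ω : Type*} [MeasurableSpace Ω] {P : Measure Ω}
    [IsProbabilityMeasure P] {Y : Ω → ℝ} (hY : AEMeasurable Y P) (hY2 : MemLp Y 2 P)
    (hmean : ∫ ω, Y ω ∂P = 0) :
    (fun t : ℝ => charFun (P.map Y) t - (1 - ((∫ ω, Y ω ^ 2 ∂P : ℝ) : ℂ) * t ^ 2 / 2)) =o[𝓝 0]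
      fun t => t ^ 2 := by
  have : IsProbabilityMeasure (P.map Y) := Measure.isProbabilityMeasure_map hY
  have hid : MemLp id 2 (P.map Y) := by
    rw [memLp_map_measure_iff aestronglyMeasurable_id hY]
    exact hY2
  have h1 := taylor_isLittleO_univ (f := charFun (P.map Y)) (x₀ := 0) (n := 2)
    (contDiff_charFun hid)
  simp only [taylorWithinEval_charFun_two_zero hY hid, hmean, sub_zero] at h1
  simpa using h1

/-- Both characteristic functions have the same second-order Taylor polynomial at 0. -/
lemma charFun_sub_gaussian_isLittleO {Ω : Type*} [MeasurableSpace Ω] {P : Measure Ω}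
    [IsProbabilityMeasure P] {Y : Ω → ℝ} (hY : AEMeasurable Y P) (hY2 : MemLp Y 2 P)
    (hmean : ∫ ω, Y ω ∂P = 0) {v : ℝ≥0} (hv : ∫ ω, Y ω ^ 2 ∂P = v) :
    (fun t : ℝ => charFun (P.map Y) t - charFun (gaussianReal 0 v) t) =o[𝓝 0] fun t => t ^ 2 := by
  have h1 := charFun_sub_isLittleO hY hY2 hmean
  have hg2 : ∫ x, (id x : ℝ) ^ 2 ∂(gaussianReal 0 v) = v := by
    have h := variance_eq_sub (memLp_id_gaussianReal (μ := 0) (v := v) 2)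
    rw [variance_id_gaussianReal] at h
    simpa using h.symm
  have h2 := charFun_sub_isLittleO (P := gaussianReal 0 v) (Y := id) aemeasurable_id
    (memLp_id_gaussianReal 2) (by simp)
  rw [hg2, Measure.map_id] at h2
  rw [hv] at h1
  refine (h1.sub h2).congr_left fun t => ?_
  ring

/-- Products of characteristic functions along small weights of unit length are close to the
Gaussian characteristic function. -/
lemma exists_norm_prod_charFun_sub_le {Ω : Type*} [MeasurableSpace Ω] {P : Measure Ω}
    [IsProbabilityMeasure P] {Y : Ω → ℝ} (hY : AEMeasurable Y P) (hY2 : MemLp Y 2 P)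
    (hmean : ∫ ω, Y ω ∂P = 0) {v : ℝ≥0} (hv : ∫ ω, Y ω ^ 2 ∂P = v) (t : ℝ) {η : ℝ} (hη : 0 < η) :
    ∃ δ > 0, ∀ (n : ℕ) (a : Fin n → ℝ), ∑ i, a i ^ 2 = 1 → (∀ i, |a i| ≤ δ) →
      ‖∏ i, charFun (P.map Y) (t * a i) - charFun (gaussianReal 0 v) t‖ ≤ η * t ^ 2 := by
  have : IsProbabilityMeasure (P.map Y) := Measure.isProbabilityMeasure_map hY
  have h1 := (charFun_sub_gaussian_isLittleO hY hY2 hmean hv).def hη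
  obtain ⟨δ, hδ, h2⟩ := Metric.eventually_nhds_iff.1 h1
  -- Ensures |t·a_i| < δ, also for `t = 0`.
  refine ⟨δ / (|t| + 1), by positivity, fun n a ha hsmall => ?_⟩
  -- Unit length of the weights makes the Gaussian characteristic function factor in the same way as
  -- the sum.
  have hg : charFun (gaussianReal 0 v) t = ∏ i, charFun (gaussianReal 0 v) (t * a i) := by
    simp only [charFun_gaussianReal]
    rw [← Complex.exp_sum]
    congr 1
    have : ((∑ i, a i ^ 2 : ℝ) : ℂ) = 1 := by rw [ha]; simp
    push_cast at this
    calc _ = -(v * t ^ 2 / 2 : ℂ) * ∑ i, (a i : ℂ) ^ 2 := by rw [this]; simp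
      _ = _ := by
        rw [Finset.mul_sum]
        refine Finset.sum_congr rfl fun i _ => ?_
        push_cast
        ring
  rw [hg]
  refine (norm_prod_sub_prod_le _ (fun i _ => norm_charFun_le_one _)
    (fun i _ => norm_charFun_le_one _)).trans ?_
  calc ∑ i, ‖charFun (P.map Y) (t * a i) - charFun (gaussianReal 0 v) (t * a i)‖
      ≤ ∑ i, η * ‖(t * a i) ^ 2‖ := by
        refine Finset.sum_le_sum fun i _ => h2 ?_
        rw [dist_zero_right, norm_mul, Real.norm_eq_abs, Real.norm_eq_abs]
        calc |t| * |a i| ≤ |t| * (δ / (|t| + 1)) := by gcongr; exact hsmall i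
          _ < (|t| + 1) * (δ / (|t| + 1)) := by
              have : 0 < δ / (|t| + 1) := by positivity
              nlinarith
          _ = δ := by field_simp
    _ = η * t ^ 2 * ∑ i, a i ^ 2 := by
        rw [Finset.mul_sum]
        refine Finset.sum_congr rfl fun i _ => ?_
        rw [Real.norm_of_nonneg (sq_nonneg _)]
        ring
    _ = η * t ^ 2 := by rw [ha, mul_one]

variable {Ω E : Type*} [MeasurableSpace Ω] {P : Measure Ω} [IsProbabilityMeasure P]
  [MeasurableSpace E] {X : ℕ → Ω → E} {ε : ℕ → Ω → ℝ}

/-- Independence within and between the pairs makes all coordinates independent; regrouping them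
separates covariates from errors, so that Fubini can freeze the covariates. -/
lemma map_covariates_errors (hX : ∀ i, Measurable (X i)) (hε : ∀ i, Measurable (ε i))
    (hXε : ∀ i, IndepFun (X i) (ε i) P) (hindep : iIndepFun (fun i ω => (X i ω, ε i ω)) P)
    (n : ℕ) :
    P.map (fun ω => ((fun i : Fin n => X i ω), (fun i : Fin n => ε i ω))) =
      (P.map fun ω => fun i : Fin n => X i ω).prod (Measure.pi fun i : Fin n => P.map (ε i)) := by
  have hpX : ∀ i, IsProbabilityMeasure (P.map (X i)) := fun i =>
    Measure.isProbabilityMeasure_map (hX i).aemeasurable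
  have hpε : ∀ i, IsProbabilityMeasure (P.map (ε i)) := fun i =>
    Measure.isProbabilityMeasure_map (hε i).aemeasurable
  have hpair : iIndepFun (fun (i : Fin n) ω => (X i ω, ε i ω)) P :=
    hindep.precomp (g := fun i : Fin n => (i : ℕ)) Fin.val_injective
  have h1 : P.map (fun ω => fun i : Fin n => (X i ω, ε i ω)) =
      Measure.pi fun i : Fin n => (P.map (X i)).prod (P.map (ε i)) := by
    rw [(iIndepFun_iff_map_fun_eq_pi_map
      fun i : Fin n => ((hX i).prodMk (hε i)).aemeasurable).1 hpair]
    congr 1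
    funext i
    exact (indepFun_iff_map_prod_eq_prod_map_map (hX i).aemeasurable (hε i).aemeasurable).1 (hXε i)
  have h2 : P.map (fun ω => fun i : Fin n => X i ω) = Measure.pi fun i : Fin n => P.map (X i) :=
    (iIndepFun_iff_map_fun_eq_pi_map fun i : Fin n => (hX i).aemeasurable).1
      (hpair.comp (fun _ p => p.1) fun _ => measurable_fst)
  have h3 := (measurePreserving_arrowProdEquivProdArrow E ℝ (Fin n) (fun i => P.map (X i))
    (fun i => P.map (ε i))).map_eq
  have hm : Measurable fun ω => fun i : Fin n => (X i ω, ε i ω) :=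
    measurable_pi_lambda _ fun i => (hX i).prodMk (hε i)
  rw [h2, ← h3, ← h1, Measure.map_map (MeasurableEquiv.measurable _) hm]
  rfl

/-- Integrate out the errors with the covariates fixed: the weights are then constants and the
exponential factors. -/
lemma charFun_weighted_sum (hX : ∀ i, Measurable (X i)) (hε : ∀ i, Measurable (ε i))
    (hεident : ∀ i, IdentDistrib (ε i) (ε 0) P P)
    (hXε : ∀ i, IndepFun (X i) (ε i) P) (hindep : iIndepFun (fun i ω => (X i ω, ε i ω)) P)
    {n : ℕ} {a : (Fin n → E) → Fin n → ℝ} (ha : ∀ i, Measurable fun x => a x i) (t : ℝ) :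
    charFun (P.map fun ω => ∑ i, a (fun i => X i ω) i * ε i ω) t =
      ∫ ω, ∏ i, charFun (P.map (ε 0)) (t * a (fun i => X i ω) i) ∂P := by
  have hpε : ∀ i, IsProbabilityMeasure (P.map (ε i)) := fun i =>
    Measure.isProbabilityMeasure_map (hε i).aemeasurable
  have hXv : Measurable fun ω => fun i : Fin n => X i ω := measurable_pi_lambda _ fun i => hX i
  have hεv : Measurable fun ω => fun i : Fin n => ε i ω := measurable_pi_lambda _ fun i => hε i
  have hpXv : IsProbabilityMeasure (P.map fun ω => fun i : Fin n => X i ω) :=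
    Measure.isProbabilityMeasure_map hXv.aemeasurable
  set F : (Fin n → E) × (Fin n → ℝ) → ℂ := fun p =>
    Complex.exp (t * (∑ i, a p.1 i * p.2 i : ℝ) * Complex.I) with hF
  have hFm : Measurable F := by
    have h1 : Measurable fun p : (Fin n → E) × (Fin n → ℝ) => ∑ i, a p.1 i * p.2 i :=
      Finset.measurable_sum _ fun i _ =>
        ((ha i).comp measurable_fst).mul ((measurable_pi_apply i).comp measurable_snd)
    fun_prop
  have hFbound : ∀ p, ‖F p‖ ≤ 1 := by
    intro p
    simp only [hF]
    rw [← Complex.ofReal_mul, Complex.norm_exp_ofReal_mul_I]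
  have hsum : Measurable fun ω => ∑ i, a (fun i => X i ω) i * ε i ω :=
    Finset.measurable_sum _ fun i _ => ((ha i).comp hXv).mul (hε i)
  rw [charFun_apply_real, integral_map hsum.aemeasurable (by fun_prop)]
  have h1 : ∫ ω, Complex.exp (t * (∑ i, a (fun i => X i ω) i * ε i ω : ℝ) * Complex.I) ∂P =
      ∫ p, F p ∂(P.map (fun ω => ((fun i : Fin n => X i ω), (fun i : Fin n => ε i ω)))) := by
    rw [integral_map (hXv.prodMk hεv).aemeasurable hFm.aestronglyMeasurable]
  rw [h1, map_covariates_errors hX hε hXε hindep, integral_prod _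
    (Integrable.of_bound hFm.aestronglyMeasurable 1 (Eventually.of_forall hFbound))]
  have h2 : ∀ x : Fin n → E, ∫ e, F (x, e) ∂(Measure.pi fun i : Fin n => P.map (ε i)) =
      ∏ i, charFun (P.map (ε 0)) (t * a x i) := by
    intro x
    have h3 : ∀ e : Fin n → ℝ, F (x, e) =
        ∏ i, Complex.exp ((t * a x i : ℝ) * e i * Complex.I) := by
      intro e
      simp only [hF]
      rw [← Complex.exp_sum]
      congr 1
      push_cast
      rw [Finset.mul_sum, Finset.sum_mul]
      exact Finset.sum_congr rfl fun i _ => by ring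
    simp only [h3]
    rw [integral_fintype_prod_eq_prod
      (f := fun (i : Fin n) (y : ℝ) => Complex.exp ((t * a x i : ℝ) * y * Complex.I))]
    refine Finset.prod_congr rfl fun i _ => ?_
    rw [charFun_apply_real, (hεident i).map_eq]
  simp only [h2]
  rw [integral_map hXv.aemeasurable]
  have hc : Measurable (charFun (P.map (ε 0))) := continuous_charFun.measurable
  exact (Finset.measurable_prod _ fun i _ =>
    hc.comp ((ha i).const_mul t)).aestronglyMeasurable

/-- The central limit theorem for weighted sums of i.i.d. errors, with random weights that are
functions of independent covariates, of unit length, and uniformly small in probability. -/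
theorem tendstoInDistribution_weighted_sum (hX : ∀ i, Measurable (X i))
    (hε : ∀ i, Measurable (ε i)) (hεident : ∀ i, IdentDistrib (ε i) (ε 0) P P)
    (hε2 : MemLp (ε 0) 2 P) (hmean : ∫ ω, ε 0 ω ∂P = 0) {v : ℝ≥0}
    (hv : ∫ ω, (ε 0 ω) ^ 2 ∂P = v) (hXε : ∀ i, IndepFun (X i) (ε i) P)
    (hindep : iIndepFun (fun i ω => (X i ω, ε i ω)) P)
    {a : (n : ℕ) → (Fin n → E) → Fin n → ℝ} (ha : ∀ n i, Measurable fun x => a n x i)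
    (hgood : ∀ δ > 0, Tendsto (fun n : ℕ => P.real {ω | ¬ (∑ i, a n (fun i => X i ω) i ^ 2 = 1 ∧
      ∀ i, |a n (fun i => X i ω) i| ≤ δ)}) atTop (𝓝 0)) :
    TendstoInDistribution (fun (n : ℕ) ω => ∑ i : Fin n, a n (fun i => X i ω) i * ε i ω) atTop
      (id : ℝ → ℝ) (fun _ => P) (gaussianReal 0 v) where
  forall_aemeasurable n := by
    have hXv : Measurable fun ω => fun i : Fin n => X i ω := measurable_pi_lambda _ fun i => hX i
    exact (Finset.measurable_sum _ fun i _ => ((ha n i).comp hXv).mul (hε i)).aemeasurable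
  tendsto := by
    refine ProbabilityMeasure.tendsto_iff_tendsto_charFun.2 fun t => ?_
    simp only [ProbabilityMeasure.coe_mk, Measure.map_id,
      charFun_weighted_sum hX hε hεident hXε hindep (ha _) t]
    have : IsProbabilityMeasure (P.map (ε 0)) := Measure.isProbabilityMeasure_map (hε 0).aemeasurable
    rw [Metric.tendsto_nhds]
    intro r hr
    -- This `η` gives an error of at most r/2 on the good event. On the bad event the difference is
    -- at most 2, hence the threshold r/4 below.
    obtain ⟨δ, hδ, hδ2⟩ := exists_norm_prod_charFun_sub_le (hε 0).aemeasurable hε2 hmean hv t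
      (η := r / (2 * (t ^ 2 + 1))) (by positivity)
    filter_upwards [(hgood δ hδ).eventually_lt_const (by positivity : 0 < r / 4)] with n hn
    have hXv : Measurable fun ω => fun i : Fin n => X i ω := measurable_pi_lambda _ fun i => hX i
    have hai : ∀ i, Measurable fun ω => a n (fun i => X i ω) i := fun i => (ha n i).comp hXv
    set bad : Set Ω := {ω | ¬ (∑ i, a n (fun i => X i ω) i ^ 2 = 1 ∧
      ∀ i, |a n (fun i => X i ω) i| ≤ δ)} with hbad
    have hbadm : MeasurableSet bad := by
      have h1 : MeasurableSet {ω | ∑ i, a n (fun i => X i ω) i ^ 2 = 1} :=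
        measurableSet_eq_fun (Finset.measurable_sum _ fun i _ => (hai i).pow_const 2)
          measurable_const
      have h2 : MeasurableSet {ω | ∀ i, |a n (fun i => X i ω) i| ≤ δ} := by
        have : {ω | ∀ i, |a n (fun i => X i ω) i| ≤ δ} =
            ⋂ i, {ω | |a n (fun i => X i ω) i| ≤ δ} := by ext ω; simp
        rw [this]
        exact MeasurableSet.iInter fun i => measurableSet_le (hai i).norm measurable_const
      exact (h1.inter h2).compl
    set Φ : Ω → ℂ := fun ω => ∏ i, charFun (P.map (ε 0)) (t * a n (fun i => X i ω) i) with hΦ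
    have hc : Measurable (charFun (P.map (ε 0))) := continuous_charFun.measurable
    have hΦm : Measurable Φ := Finset.measurable_prod _ fun i _ => hc.comp ((hai i).const_mul t)
    have hΦb : ∀ ω, ‖Φ ω‖ ≤ 1 := fun ω => by
      rw [hΦ, norm_prod]
      exact Finset.prod_le_one (fun i _ => norm_nonneg _) fun i _ => norm_charFun_le_one _
    have hΦi : Integrable Φ P :=
      Integrable.of_bound hΦm.aestronglyMeasurable 1 (Eventually.of_forall hΦb)
    rw [dist_eq_norm]
    have h1 : ∫ ω, Φ ω ∂P - charFun (gaussianReal 0 v) t =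
        ∫ ω, (Φ ω - charFun (gaussianReal 0 v) t) ∂P := by
      rw [integral_sub hΦi (integrable_const _)]
      simp
    have hpt : ∀ ω, ‖Φ ω - charFun (gaussianReal 0 v) t‖ ≤
        r / 2 + bad.indicator (fun _ => (2 : ℝ)) ω := by
      intro ω
      by_cases hω : ω ∈ bad
      · rw [Set.indicator_of_mem hω]
        have h2 := norm_sub_le (Φ ω) (charFun (gaussianReal 0 v) t)
        have h3 := hΦb ω
        have h4 := norm_charFun_le_one (μ := gaussianReal 0 v) t
        linarith
      · rw [Set.indicator_of_notMem hω, add_zero]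
        have hω' := not_not.1 hω
        refine (hδ2 n _ hω'.1 hω'.2).trans ?_
        rw [div_mul_eq_mul_div, div_le_div_iff₀ (by positivity) (by positivity)]
        nlinarith
    rw [h1]
    calc ‖∫ ω, (Φ ω - charFun (gaussianReal 0 v) t) ∂P‖
        ≤ ∫ ω, ‖Φ ω - charFun (gaussianReal 0 v) t‖ ∂P := norm_integral_le_integral_norm _
      _ ≤ ∫ ω, (r / 2 + bad.indicator (fun _ => (2 : ℝ)) ω) ∂P := by
          refine integral_mono (hΦi.sub (integrable_const _)).norm
            ((integrable_const _).add ((integrable_const _).indicator hbadm)) hpt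
      _ = r / 2 + 2 * P.real bad := by
          rw [integral_add (integrable_const _) ((integrable_const _).indicator hbadm),
            integral_indicator_const _ hbadm]
          simp [mul_comm]
      _ < r := by linarith

end CentralLimit

/-! ### Tail bounds for the number of covariates in a set -/

section Counting

variable {Ω E : Type*}

open Classical in
/-- The number of the first `n` covariates in the set `A`. -/
noncomputable def hitCount (X : ℕ → Ω → E) (A : Set E) (n : ℕ) (ω : Ω) : ℕ :=
  Finset.card {i : Fin n | X i ω ∈ A}

lemma hitCount_eq_sum (X : ℕ → Ω → E) (A : Set E) (n : ℕ) (ω : Ω) :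
    (hitCount X A n ω : ℝ) = ∑ i : Fin n, A.indicator (fun _ => (1 : ℝ)) (X i ω) := by
  classical
  unfold hitCount
  rw [← Finset.sum_boole]
  refine Finset.sum_congr rfl fun i _ => ?_
  rw [Set.indicator_apply]

variable [MeasurableSpace Ω] {P : Measure Ω} [IsProbabilityMeasure P] [MeasurableSpace E]
  {X : ℕ → Ω → E} {A : Set E}

lemma integral_hitCount (hX : ∀ i, Measurable (X i)) (hA : MeasurableSet A) (n : ℕ) :
    ∫ ω, (hitCount X A n ω : ℝ) ∂P = ∑ i : Fin n, P.real (X i ⁻¹' A) := by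
  simp only [hitCount_eq_sum]
  have h1 : ∀ i : Fin n, (fun ω => A.indicator (fun _ => (1 : ℝ)) (X i ω)) =
      (X i ⁻¹' A).indicator fun _ => 1 := fun i => by
    funext ω
    by_cases hω : X i ω ∈ A <;> simp [hω]
  rw [integral_finsetSum]
  · refine Finset.sum_congr rfl fun i _ => ?_
    rw [h1, integral_indicator_const _ (hX i hA)]
    simp
  · intro i _
    rw [h1]
    exact (integrable_const _).indicator (hX i hA)

lemma measurable_hitCount (hX : ∀ i, Measurable (X i)) (hA : MeasurableSet A) (n : ℕ) :
    Measurable fun ω => (hitCount X A n ω : ℝ) := by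
  simp only [hitCount_eq_sum]
  exact Finset.measurable_sum _ fun i _ => (measurable_const.indicator hA).comp (hX i)

/-- Markov's inequality for the number of covariates in a set. -/
lemma measureReal_le_mul_hitCount_le (hX : ∀ i, Measurable (X i)) (hA : MeasurableSet A)
    {p w τ : ℝ} (hp : ∀ i, P.real (X i ⁻¹' A) ≤ p) (hw : 0 ≤ w) (hτ : 0 < τ) (n : ℕ) :
    P.real {ω | τ ≤ w * hitCount X A n ω} ≤ w * (n * p) / τ := by
  have hInt : Integrable (fun ω => w * (hitCount X A n ω : ℝ)) P := by
    refine Integrable.of_bound ((measurable_hitCount hX hA n).const_mul w).aestronglyMeasurable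
      (w * n) (Eventually.of_forall fun ω => ?_)
    rw [Real.norm_of_nonneg (by positivity)]
    gcongr
    classical
    exact (Finset.card_le_univ _).trans (by simp)
  have h1 := mul_meas_ge_le_integral_of_nonneg (μ := P)
    (Eventually.of_forall fun ω => (by positivity : 0 ≤ w * (hitCount X A n ω : ℝ))) hInt τ
  rw [le_div_iff₀ hτ, mul_comm]
  refine h1.trans ?_
  rw [integral_const_mul, integral_hitCount hX hA]
  gcongr
  calc ∑ i : Fin n, P.real (X i ⁻¹' A) ≤ ∑ i : Fin n, p := Finset.sum_le_sum fun i _ => hp i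
    _ = n * p := by simp

/-- The Chernoff bound for the lower tail of the number of covariates in a set. -/
lemma measureReal_hitCount_le (hX : ∀ i, Measurable (X i)) (hindep : iIndepFun X P)
    (hA : MeasurableSet A) {p : ℝ} (hp0 : 0 ≤ p) (hp : ∀ i, p ≤ P.real (X i ⁻¹' A)) (n : ℕ) :
    P.real {ω | (hitCount X A n ω : ℝ) ≤ n * p / 2} ≤ Real.exp (-(n * p / 8)) := by
  set Z : Fin n → Ω → ℝ := fun i ω => A.indicator (fun _ => (1 : ℝ)) (X i ω) with hZ
  have hind : Measurable (A.indicator fun _ => (1 : ℝ)) := measurable_const.indicator hA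
  have hZm : ∀ i, Measurable (Z i) := fun i => hind.comp (hX i)
  have hZi : iIndepFun Z P :=
    (hindep.precomp (g := fun i : Fin n => (i : ℕ)) Fin.val_injective).comp
      (fun _ => A.indicator fun _ => (1 : ℝ)) fun _ => hind
  -- At parameter -1 each factor is at most 1 - (1 - e⁻¹)p ≤ exp(-5p/8); against the threshold np/2
  -- the exponent is np(1/2 - 5/8) = -np/8.
  have hexp : Real.exp (-1) ≤ 3 / 8 := by
    rw [Real.exp_neg, inv_le_comm₀ (Real.exp_pos 1) (by norm_num)]
    have := Real.exp_one_gt_d9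
    linarith
  have hmgf : ∀ i, mgf (Z i) P (-1) ≤ Real.exp (-(5 / 8 * p)) := by
    intro i
    have h1 : ∀ ω, Real.exp (-1 * Z i ω) =
        1 - (X i ⁻¹' A).indicator (fun _ => 1 - Real.exp (-1)) ω := by
      intro ω
      by_cases hω : X i ω ∈ A
      · simp [hZ, hω]
      · simp [hZ, hω]
    unfold mgf
    simp only [h1]
    rw [integral_sub (integrable_const _) ((integrable_const _).indicator (hX i hA)),
      integral_indicator_const _ (hX i hA)]
    simp only [integral_const, probReal_univ, smul_eq_mul, mul_one]
    have h2 := Real.add_one_le_exp (-(5 / 8 * p))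
    nlinarith [hp i]
  have hsum : ∀ ω, (hitCount X A n ω : ℝ) = (∑ i, Z i) ω := fun ω => by
    rw [hitCount_eq_sum, Finset.sum_apply]
  have hbound : ∀ ω, |(∑ i, Z i) ω| ≤ n := fun ω => by
    rw [← hsum, abs_of_nonneg (by positivity)]
    classical
    exact_mod_cast (Finset.card_le_univ _).trans (by simp)
  have hSm : Measurable (∑ i, Z i) := by
    rw [Finset.sum_fn]
    exact Finset.measurable_sum _ fun i _ => hZm i
  have h3 := measure_le_le_exp_mul_mgf (μ := P) (X := ∑ i, Z i) (t := -1) (n * p / 2)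
    (by norm_num) (by
      refine Integrable.of_bound (by fun_prop) (Real.exp n) (Eventually.of_forall fun ω => ?_)
      rw [Real.norm_of_nonneg (Real.exp_pos _).le]
      refine Real.exp_le_exp.2 ?_
      have := neg_le_of_abs_le (hbound ω)
      linarith)
  simp only [hsum]
  refine h3.trans ?_
  rw [hZi.mgf_sum hZm]
  calc _ ≤ Real.exp (-(-1) * (n * p / 2)) * ∏ _i : Fin n, Real.exp (-(5 / 8 * p)) := by
        gcongr with i
        · exact fun i _ => mgf_nonneg
        · exact hmgf i
    _ = Real.exp (-(n * p / 8)) := by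
        rw [Finset.prod_const, Finset.card_univ, Fintype.card_fin, ← Real.exp_nat_mul,
          ← Real.exp_add]
        congr 1
        ring

end Counting

/-! ### Probabilities of leaves and balls, and the union bound -/

section Leaves

variable {d : ℕ}

lemma measurableSet_unitCube : MeasurableSet (unitCube d) :=
  IsHyperrectangle.measurableSet ⟨fun _ => Set.Icc 0 1, fun _ => Set.ordConnected_Icc, rfl⟩

/-- The leaves are disjoint and fill the cube. This bounds their number in the union bound. -/
lemma card_leaves_mul_le (q : TreeStructure d) {v : ℝ}
    (hv : ∀ A ∈ q.leaves, v ≤ (volume A).toReal) :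
    q.leaves.card * v ≤ (volume (unitCube d)).toReal := by
  have hfin : volume (unitCube d) ≠ ⊤ := isBounded_unitCube.measure_lt_top.ne
  have h1 : volume (unitCube d) = ∑ A ∈ q.leaves, volume A := by
    conv_lhs => rw [← q.cover]
    exact measure_biUnion_finset q.disjoint fun A hA => (q.hyperrectangle A hA).measurableSet
  rw [h1, ENNReal.toReal_sum fun A hA =>
    ne_top_of_le_ne_top hfin (measure_mono (q.leaf_subset hA)), ← nsmul_eq_mul]
  exact Finset.card_nsmul_le_sum _ _ _ hv

variable {Ω : Type*} [MeasurableSpace Ω] {P : Measure Ω} {Y : Ω → Cov d} {dens : Cov d → ℝ}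
  {c₁ c₂ : ℝ}

lemma mul_volume_le_measureReal [IsProbabilityMeasure P] (hY : Measurable Y)
    (hdens_bound : ∀ z ∈ unitCube d, c₁ ≤ dens z ∧ dens z ≤ c₂) (hc₁ : 0 < c₁)
    (hlaw : P.map Y =
      (volume.restrict (unitCube d)).withDensity (fun z => ENNReal.ofReal (dens z)))
    {A : Set (Cov d)} (hA : MeasurableSet A) (hAc : A ⊆ unitCube d) :
    c₁ * (volume A).toReal ≤ P.real (Y ⁻¹' A) := by
  have h1 : ENNReal.ofReal c₁ * volume A ≤ P (Y ⁻¹' A) := by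
    rw [← Measure.map_apply hY hA, hlaw, withDensity_apply _ hA, Measure.restrict_restrict hA,
      Set.inter_eq_left.2 hAc, ← setLIntegral_const]
    exact setLIntegral_mono' hA fun z hz => ENNReal.ofReal_le_ofReal (hdens_bound z (hAc hz)).1
  have h2 := ENNReal.toReal_mono (measure_ne_top P _) h1
  rwa [ENNReal.toReal_mul, ENNReal.toReal_ofReal hc₁.le] at h2

lemma measureReal_closedBall_le
    (hY : Measurable Y) (hdens_bound : ∀ z ∈ unitCube d, c₁ ≤ dens z ∧ dens z ≤ c₂)
    (hlaw : P.map Y =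
      (volume.restrict (unitCube d)).withDensity (fun z => ENNReal.ofReal (dens z)))
    (hc₂ : 0 ≤ c₂) (x : Cov d) {D : ℝ} (hD : 0 ≤ D) :
    P.real (Y ⁻¹' Metric.closedBall x D) ≤
      c₂ * (volume (Metric.ball (0 : Cov d) 1)).toReal * D ^ d := by
  have hB : MeasurableSet (Metric.closedBall x D) := measurableSet_closedBall
  have h1 : P (Y ⁻¹' Metric.closedBall x D) ≤
      ENNReal.ofReal c₂ * volume (Metric.closedBall x D) := by
    rw [← Measure.map_apply hY hB, hlaw, withDensity_apply _ hB, Measure.restrict_restrict hB]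
    calc _ ≤ ∫⁻ _ in Metric.closedBall x D ∩ unitCube d, ENNReal.ofReal c₂ :=
          setLIntegral_mono' (hB.inter measurableSet_unitCube)
            fun z hz => ENNReal.ofReal_le_ofReal (hdens_bound z hz.2).2
      _ ≤ _ := by
          rw [setLIntegral_const]
          gcongr
          exact Set.inter_subset_left
  rw [Measure.addHaar_closedBall _ _ hD, finrank_euclideanSpace, Fintype.card_fin] at h1
  have h2 := ENNReal.toReal_mono (ENNReal.mul_ne_top ENNReal.ofReal_ne_top
    (ENNReal.mul_ne_top ENNReal.ofReal_ne_top measure_ball_lt_top.ne)) h1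
  rw [ENNReal.toReal_mul, ENNReal.toReal_mul, ENNReal.toReal_ofReal hc₂,
    ENNReal.toReal_ofReal (by positivity)] at h2
  refine h2.trans (le_of_eq ?_)
  ring

/-- The union bound for the event that some leaf holds few covariates. -/
lemma measureReal_exists_leaf_le [IsProbabilityMeasure P] {X : ℕ → Ω → Cov d}
    (hX : ∀ i, Measurable (X i)) (hindep : iIndepFun X P)
    (hdens_bound : ∀ z ∈ unitCube d, c₁ ≤ dens z ∧ dens z ≤ c₂) (hc₁ : 0 < c₁)
    (hlaw : ∀ i, P.map (X i) =
      (volume.restrict (unitCube d)).withDensity (fun z => ENNReal.ofReal (dens z)))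
    (Q : Finset (TreeStructure d)) {v : ℝ} (hv : 0 < v)
    (hvol : ∀ q ∈ Q, ∀ A ∈ q.leaves, v ≤ (volume A).toReal) (n : ℕ) :
    P.real {ω | ∃ q ∈ Q, ∃ A ∈ q.leaves, (hitCount X A n ω : ℝ) ≤ n * (c₁ * v) / 2} ≤
      Q.card * ((volume (unitCube d)).toReal / v * Real.exp (-(n * (c₁ * v) / 8))) := by
  have hset : {ω | ∃ q ∈ Q, ∃ A ∈ q.leaves, (hitCount X A n ω : ℝ) ≤ n * (c₁ * v) / 2} =
      ⋃ q ∈ Q, ⋃ A ∈ q.leaves, {ω | (hitCount X A n ω : ℝ) ≤ n * (c₁ * v) / 2} := by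
    ext ω; simp
  rw [hset]
  refine (measureReal_biUnion_finset_le _ _).trans ?_
  refine (Finset.sum_le_sum (g := fun _ => (volume (unitCube d)).toReal / v *
    Real.exp (-(n * (c₁ * v) / 8))) fun q hq => ?_).trans (by simp)
  refine (measureReal_biUnion_finset_le _ _).trans ?_
  calc _ ≤ q.leaves.card • Real.exp (-(n * (c₁ * v) / 8)) := by
        refine Finset.sum_le_card_nsmul _ _ _ fun A hA => ?_
        have hAm := (q.hyperrectangle A hA).measurableSet
        refine measureReal_hitCount_le hX hindep hAm (by positivity) (fun i => ?_) n
        refine le_trans ?_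
          (mul_volume_le_measureReal (hX i) hdens_bound hc₁ (hlaw i) hAm (q.leaf_subset hA))
        exact mul_le_mul_of_nonneg_left (hvol q hq A hA) hc₁.le
    _ ≤ _ := by
        rw [nsmul_eq_mul]
        gcongr
        rw [le_div_iff₀ hv]
        exact card_leaves_mul_le q (hvol q hq)

end Leaves

/-! ### Size, bias and measurability of the ridge weights -/

section RidgeWeights

variable {d n : ℕ} {s : Sample d n} {Q : Finset (TreeStructure d)} {law : PMF Q} {m : ℕ}
  {lam a D : ℝ} {x : Cov d}

lemma ridge_mulVec_ridgeWeights (h0 : 0 < lam) (h1 : lam < 1) :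
    ((1 / lam) • (1 : Matrix (Fin n) (Fin n) ℝ) + kernelMatrix s law m).mulVec
      (ridgeWeights lam s law m x) = expectedStructureVector s law m x := by
  have h : (ridgeWeights lam s law m x : Fin n → ℝ) =
      ((1 / lam) • (1 : Matrix (Fin n) (Fin n) ℝ) + kernelMatrix s law m)⁻¹.mulVec
        (expectedStructureVector s law m x) :=
    vecMul_inv_ridge (kernelMatrix_isSymm s law m) _
  rw [h]
  exact ridge_mulVec_inv_mulVec (kernelMatrix_nonneg s law m) (sum_kernelMatrix_le_one s law m)
    h0 h1 _

lemma abs_ridgeWeights_le (h0 : 0 < lam) (h1 : lam < 1) (ha : 0 < a)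
    (hcount : ∀ q ∈ Q, a ≤ leafCount s q x) (k : Fin n) :
    |ridgeWeights lam s law m x k| ≤ lam / (1 - lam) * (1 / a) := by
  refine abs_le_of_ridge_mulVec (kernelMatrix_nonneg s law m) (sum_kernelMatrix_le_one s law m)
    h0 h1 (u := ridgeWeights lam s law m x) (fun i => ?_) k
  rw [ridge_mulVec_ridgeWeights h0 h1, abs_of_nonneg (expectedStructureVector_nonneg s law m x i)]
  exact expectedStructureVector_le s law m ha hcount i

open Classical in
/-- The ridge weights are not small: they are spread over the sample points near `x`. -/
lemma one_le_norm_ridgeWeights_sq_mul (h0 : 0 < lam) (h1 : lam < 1) (hm : m ≤ n)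
    (hcount : ∀ q ∈ Q, a ≤ leafCount s q x)
    (hdiam : ∀ q ∈ Q, ∀ A ∈ q.leaves, Metric.diam A ≤ D)
    (hδ : Real.exp (-(m * a / n : ℝ)) ≤ 1 / 2) :
    1 ≤ 4 * (1 / lam + 1) ^ 2 * ‖ridgeWeights lam s law m x‖ ^ 2 *
      (Finset.card {i | (s i).1 ∈ Metric.closedBall x D} : ℝ) := by
  set k := expectedStructureVector s law m x with hk
  set N : Finset (Fin n) := {i | (s i).1 ∈ Metric.closedBall x D} with hN
  have hsum : 1 / 2 ≤ ∑ i, k i := by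
    have := one_sub_le_sum_expectedStructureVector s law m hm hcount
    linarith
  have hsupp : ∑ i, k i = ∑ i ∈ N, k i := by
    refine (Finset.sum_subset (Finset.subset_univ N) fun i _ hi => ?_).symm
    by_contra hne
    apply hi
    have := dist_le_of_expectedStructureVector_ne_zero s law m hdiam hne
    simpa [hN, dist_comm] using this
  -- Mass at least 1/2 on `N` points forces ∑ k_i² ≥ 1/(4·card N).
  have hcs : (∑ i ∈ N, k i) ^ 2 ≤ N.card * ∑ i ∈ N, k i ^ 2 := sq_sum_le_card_mul_sum_sq
  have hle : ∑ i ∈ N, k i ^ 2 ≤ ∑ i, k i ^ 2 :=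
    Finset.sum_le_univ_sum_of_nonneg fun i => sq_nonneg _
  have hnorm : ∑ i, k i ^ 2 ≤ ((1 / lam + 1) * ‖ridgeWeights lam s law m x‖) ^ 2 := by
    have h2 := norm_le_norm_ridge (kernelMatrix_nonneg s law m) (sum_kernelMatrix_le_one s law m)
      (kernelMatrix_isSymm s law m) h0 (ridgeWeights lam s law m x)
    rw [ridge_mulVec_ridgeWeights h0 h1] at h2
    have h3 := pow_le_pow_left₀ (norm_nonneg _) h2 2
    rw [EuclideanSpace.norm_sq_eq] at h3
    simpa using h3
  have hquarter : (1 / 4 : ℝ) ≤ (∑ i ∈ N, k i) ^ 2 := by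
    rw [← hsupp]
    nlinarith
  have hfinal : (1 / 4 : ℝ) ≤ N.card * ((1 / lam + 1) * ‖ridgeWeights lam s law m x‖) ^ 2 := by
    refine hquarter.trans (hcs.trans ?_)
    gcongr
    exact hle.trans hnorm
  nlinarith

/-- The error is the oscillation of `f` within leaf diameter, at most L·D, plus the missing mass
times |f z|. -/
lemma abs_sub_sum_expectedStructureVector_le {f : Cov d → ℝ} {L : ℝ≥0} {B δ : ℝ}
    (hf : LipschitzOnWith L f (unitCube d)) (hB : ∀ z ∈ unitCube d, |f z| ≤ B)
    (hs : ∀ i, (s i).1 ∈ unitCube d) {z : Cov d} (hz : z ∈ unitCube d)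
    (hdiam : ∀ q ∈ Q, ∀ A ∈ q.leaves, Metric.diam A ≤ D)
    (hδ : 1 - δ ≤ ∑ k, expectedStructureVector s law m z k) (hD : 0 ≤ D) :
    |f z - ∑ k, expectedStructureVector s law m z k * f (s k).1| ≤ L * D + B * δ := by
  set k := expectedStructureVector s law m z with hk
  have hk0 : ∀ i, 0 ≤ k i := expectedStructureVector_nonneg s law m z
  have hk1 : ∑ i, k i ≤ 1 := sum_expectedStructureVector_le_one s law m z
  have hB0 : 0 ≤ B := (abs_nonneg _).trans (hB z hz)
  have h1 : f z - ∑ i, k i * f (s i).1 =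
      ∑ i, k i * (f z - f (s i).1) + (1 - ∑ i, k i) * f z := by
    simp only [mul_sub, Finset.sum_sub_distrib, ← Finset.sum_mul]
    ring
  rw [h1]
  refine (abs_add_le _ _).trans (add_le_add ?_ ?_)
  · calc |∑ i, k i * (f z - f (s i).1)| ≤ ∑ i, |k i * (f z - f (s i).1)| :=
          Finset.abs_sum_le_sum_abs _ _
      _ ≤ ∑ i, k i * (L * D) := by
          refine Finset.sum_le_sum fun i _ => ?_
          rw [abs_mul, abs_of_nonneg (hk0 i)]
          rcases eq_or_ne (k i) 0 with h | h
          · simp [h]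
          refine mul_le_mul_of_nonneg_left ?_ (hk0 i)
          calc |f z - f (s i).1| = dist (f z) (f (s i).1) := (Real.dist_eq _ _).symm
            _ ≤ L * dist z (s i).1 := hf.dist_le_mul z hz _ (hs i)
            _ ≤ L * D := by
                gcongr
                exact dist_le_of_expectedStructureVector_ne_zero s law m hdiam h
      _ = (∑ i, k i) * (L * D) := by rw [Finset.sum_mul]
      _ ≤ 1 * (L * D) := mul_le_mul_of_nonneg_right hk1 (by positivity)
      _ = L * D := one_mul _
  · rw [abs_mul, abs_of_nonneg (by linarith), mul_comm]
    exact mul_le_mul (hB z hz) (by linarith) (by linarith) hB0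

/-- The bias of the kernel ridge prediction. -/
lemma abs_bias_le {f : Cov d → ℝ} {L : ℝ≥0} {B : ℝ} (h0 : 0 < lam) (h1 : lam < 1) (hm : m ≤ n)
    (hf : LipschitzOnWith L f (unitCube d)) (hB : ∀ z ∈ unitCube d, |f z| ≤ B)
    (hs : ∀ i, (s i).1 ∈ unitCube d) (hx : x ∈ unitCube d)
    (hcount : ∀ q ∈ Q, ∀ z ∈ unitCube d, a ≤ leafCount s q z)
    (hdiam : ∀ q ∈ Q, ∀ A ∈ q.leaves, Metric.diam A ≤ D) (hD : 0 ≤ D) :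
    |∑ k, ridgeWeights lam s law m x k * f (s k).1 - lam / (1 + lam) * f x| ≤
      1 / (1 - lam) * (L * D + B * Real.exp (-(m * a / n : ℝ))) := by
  set δ := Real.exp (-(m * a / n : ℝ)) with hδ
  set η := L * D + B * δ with hη
  set K := kernelMatrix s law m with hK
  set A := (1 / lam) • (1 : Matrix (Fin n) (Fin n) ℝ) + K with hA
  set h : Fin n → ℝ := fun i => f (s i).1 with hh
  set k := expectedStructureVector s law m x with hk
  set θ := lam / (1 + lam) with hθ
  have hpos : 0 < 1 - lam := by linarith
  have hpos' : 0 < 1 + lam := by linarith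
  have hθ0 : 0 ≤ θ := by positivity
  have hθ1 : θ ≤ 1 := by rw [hθ, div_le_one hpos']; linarith
  have hB0 : 0 ≤ B := (abs_nonneg _).trans (hB x hx)
  have hη0 : 0 ≤ η := by positivity
  have hKnn := kernelMatrix_nonneg s law m
  have hKrow := sum_kernelMatrix_le_one s law m
  have hrow : ∀ z ∈ unitCube d, 1 - δ ≤ ∑ j, expectedStructureVector s law m z j := fun z hz =>
    one_sub_le_sum_expectedStructureVector s law m hm fun q hq => hcount q hq z hz
  have hKh : ∀ i, |h i - K.mulVec h i| ≤ η := fun i =>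
    abs_sub_sum_expectedStructureVector_le hf hB hs (hs i) hdiam (hrow _ (hs i)) hD
  have hkh : |f x - ∑ j, k j * h j| ≤ η :=
    abs_sub_sum_expectedStructureVector_le hf hB hs hx hdiam (hrow _ hx) hD
  set u := A⁻¹.mulVec h with hu
  have hAu : A.mulVec u = h := ridge_mulVec_inv_mulVec hKnn hKrow h0 h1 h
  -- As 1 - θ/λ = θ, the ridge matrix maps u - θh to θ(h - Kh), which is small because `K` almost
  -- fixes `h`; the sup-norm bound inverts this.
  have herr : ∀ i, |u i - θ * h i| ≤ lam / (1 - lam) * η := by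
    refine abs_le_of_ridge_mulVec hKnn hKrow h0 h1 (u := fun i => u i - θ * h i) fun i => ?_
    have h2 : A.mulVec (fun i => u i - θ * h i) i = θ * (h i - K.mulVec h i) := by
      have h3 : (fun i => u i - θ * h i) = u - θ • h := rfl
      rw [h3, Matrix.mulVec_sub, Matrix.mulVec_smul, hAu, Pi.sub_apply, Pi.smul_apply,
        ridge_mulVec_apply, smul_eq_mul, hθ]
      field_simp
      ring
    rw [h2, abs_mul, abs_of_nonneg hθ0]
    exact (mul_le_of_le_one_left (abs_nonneg _) hθ1).trans (hKh i)
  have hru : ∑ j, ridgeWeights lam s law m x j * h j = ∑ j, k j * u j := by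
    have h2 : ∑ j, ridgeWeights lam s law m x j * h j = Matrix.vecMul k A⁻¹ ⬝ᵥ h := rfl
    rw [h2, ← Matrix.dotProduct_mulVec]
    rfl
  have hsplit : ∑ j, ridgeWeights lam s law m x j * h j - θ * f x =
      ∑ j, k j * (u j - θ * h j) - θ * (f x - ∑ j, k j * h j) := by
    rw [hru]
    simp only [mul_sub, Finset.sum_sub_distrib, Finset.mul_sum]
    have : ∑ j, k j * (θ * h j) = ∑ j, θ * (k j * h j) :=
      Finset.sum_congr rfl fun j _ => by ring
    rw [this]
    ring
  have hkerr : |∑ j, k j * (u j - θ * h j)| ≤ lam / (1 - lam) * η := by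
    calc _ ≤ ∑ j, |k j * (u j - θ * h j)| := Finset.abs_sum_le_sum_abs _ _
      _ ≤ ∑ j, k j * (lam / (1 - lam) * η) := by
          refine Finset.sum_le_sum fun j _ => ?_
          have hkj := expectedStructureVector_nonneg s law m x j
          rw [abs_mul, abs_of_nonneg hkj]
          exact mul_le_mul_of_nonneg_left (herr j) hkj
      _ = (∑ j, k j) * (lam / (1 - lam) * η) := by rw [Finset.sum_mul]
      _ ≤ 1 * (lam / (1 - lam) * η) :=
          mul_le_mul_of_nonneg_right (sum_expectedStructureVector_le_one s law m x) (by positivity)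
      _ = _ := one_mul _
  rw [hsplit]
  calc _ ≤ lam / (1 - lam) * η + η := by
        refine (abs_sub _ _).trans (add_le_add hkerr ?_)
        rw [abs_mul, abs_of_nonneg hθ0]
        exact (mul_le_of_le_one_left (abs_nonneg _) hθ1).trans hkh
    _ = 1 / (1 - lam) * η := by field_simp; ring

/-- Structure vectors never read the responses. Replacing these by 0 exhibits the weights as a
function of the covariates. -/
lemma ridgeWeights_congr {law' : PMF Q} {s' : Sample d n} (hs : ∀ i, (s i).1 = (s' i).1)
    (hlaw : law = law') : ridgeWeights lam s law m x = ridgeWeights lam s' law' m x := by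
  subst hlaw
  have h1 : structureVector s = structureVector s' := by
    have h : (fun i => ((s i).1, (0 : ℝ))) = fun i => ((s' i).1, 0) := funext fun i => by rw [hs]
    calc structureVector s = structureVector (fun i => ((s i).1, 0)) := rfl
      _ = structureVector (fun i => ((s' i).1, 0)) := by rw [h]
      _ = structureVector s' := rfl
  have h2 : expectedStructureVector s law m = expectedStructureVector s' law m := by
    funext z k
    unfold expectedStructureVector
    rw [h1]
  have h3 : kernelMatrix s law m = kernelMatrix s' law m := by
    unfold kernelMatrix
    rw [h2]
    simp only [hs]
  unfold ridgeWeights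
  rw [h2, h3]

lemma measurable_matrix_det {α ι : Type*} [MeasurableSpace α] [Fintype ι] [DecidableEq ι]
    {T : α → Matrix ι ι ℝ} (hT : ∀ i j, Measurable fun t => T t i j) :
    Measurable fun t => (T t).det := by
  simp only [Matrix.det_apply']
  exact Finset.measurable_sum _ fun σ _ =>
    (Finset.measurable_prod _ fun i _ => hT (σ i) i).const_mul _

/-- Cramer's rule: adjugate entries and the determinant are polynomials in the entries. -/
lemma measurable_matrix_inv_apply {α ι : Type*} [MeasurableSpace α] [Fintype ι] [DecidableEq ι]
    {T : α → Matrix ι ι ℝ} (hT : ∀ i j, Measurable fun t => T t i j) (i j : ι) :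
    Measurable fun t => (T t)⁻¹ i j := by
  simp only [Matrix.inv_def, Ring.inverse_eq_inv', Matrix.smul_apply, smul_eq_mul,
    Matrix.adjugate_apply]
  refine (measurable_matrix_det hT).inv.mul (measurable_matrix_det fun i' j' => ?_)
  simp only [Matrix.updateRow_apply]
  split_ifs
  · exact measurable_const
  · exact hT i' j'

lemma measurable_ridgeWeights {law : Sample d n → PMF Q}
    (hlaw : ∀ q, Measurable fun s => law s q) (m : ℕ) (lam : ℝ) (x : Cov d) :
    Measurable fun s => ridgeWeights lam s (law s) m x := by
  have hk : ∀ k, Measurable fun s => expectedStructureVector s (law s) m x k := fun k =>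
    measurable_expectedStructureVector hlaw m k measurable_const
  have hK : ∀ i j, Measurable fun s => kernelMatrix s (law s) m i j := fun i j =>
    measurable_expectedStructureVector hlaw m j (measurable_pi_apply i).fst
  have hinv : ∀ i j, Measurable fun s =>
      ((1 / lam) • (1 : Matrix (Fin n) (Fin n) ℝ) + kernelMatrix s (law s) m)⁻¹ i j :=
    measurable_matrix_inv_apply fun i j => by
      simp only [Matrix.add_apply]
      exact measurable_const.add (hK i j)
  refine (WithLp.measurable_toLp 2 (Fin n → ℝ)).comp (measurable_pi_lambda _ fun j => ?_)
  simp only [Matrix.vecMul, dotProduct]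
  exact Finset.measurable_sum _ fun i _ => (hk i).mul (hinv i j)

end RidgeWeights

/-! ### Comparison of the rates -/

section Rates

lemma tendsto_natCast_rpow_neg {γ : ℝ} (hγ : γ < 0) :
    Tendsto (fun n : ℕ => (n : ℝ) ^ γ) atTop (𝓝 0) := by
  have h := (tendsto_rpow_neg_atTop (neg_pos.2 hγ)).comp tendsto_natCast_atTop_atTop
  simpa [Function.comp_def] using h

lemma tendsto_natCast_rpow_atTop {γ : ℝ} (hγ : 0 < γ) :
    Tendsto (fun n : ℕ => (n : ℝ) ^ γ) atTop atTop :=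
  (tendsto_rpow_atTop hγ).comp tendsto_natCast_atTop_atTop

lemma natCast_mul_rpow_volume_rate (d : ℕ) (ν : ℝ) {n : ℕ} (hn : 0 < n) :
    (n : ℝ) * (n : ℝ) ^ (-(((d : ℝ) + 1) / ((d : ℝ) + 2)) + ν) =
      (n : ℝ) ^ (1 / ((d : ℝ) + 2) + ν) := by
  have hn' : (0 : ℝ) < n := by exact_mod_cast hn
  nth_rewrite 1 [← Real.rpow_one (n : ℝ)]
  rw [← Real.rpow_add hn']
  congr 1
  field_simp
  ring

/-- The union bound over all leaves vanishes under the rates on the tree spaces. -/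
lemma tendsto_union_bound {d : ℕ} {Q : ℕ → Finset (TreeStructure d)} {ν α : ℝ} (hν : 0 < ν)
    (hcard : TreeSpaceRate Q ν α) {c κ V : ℝ} (hc : 0 < c) (hκ : 0 < κ) (hV : 0 ≤ V) :
    Tendsto (fun n : ℕ => ((Q n).card : ℝ) *
      (V / (c * (n : ℝ) ^ (-(((d : ℝ) + 1) / ((d : ℝ) + 2)) + ν)) *
        Real.exp (-(n * (κ * (c * (n : ℝ) ^ (-(((d : ℝ) + 1) / ((d : ℝ) + 2)) + ν))) / 8))))
      atTop (𝓝 0) := by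
  set β : ℝ := 1 / ((d : ℝ) + 2) with hβ
  have hβ0 : 0 < β := by positivity
  obtain ⟨C, hC0, hC⟩ := hcard.exists_pos
  have hC := hC.bound
  have hsmall : ∀ᶠ n : ℕ in atTop, (n : ℝ) ^ (-(2 * ν)) ≤ κ * c / 8 :=
    ((tendsto_natCast_rpow_neg (by linarith : -(2 * ν) < 0)).eventually_lt_const
      (by positivity : 0 < κ * c / 8)).mono fun n hn => hn.le
  have hlim : Tendsto (fun n : ℕ => C * (V / c) *
      Real.exp (-(κ * c / 16 * (n : ℝ) ^ (β + ν)))) atTop (𝓝 0) := by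
    have h1 : Tendsto (fun n : ℕ => κ * c / 16 * (n : ℝ) ^ (β + ν)) atTop atTop :=
      (tendsto_natCast_rpow_atTop (by linarith)).const_mul_atTop (by positivity)
    simpa using (Real.tendsto_exp_neg_atTop_nhds_zero.comp h1).const_mul (C * (V / c))
  refine squeeze_zero' (Eventually.of_forall fun n => by positivity) ?_ hlim
  filter_upwards [hC, hsmall, eventually_gt_atTop 0] with n hn1 hn2 hn0
  have hn' : (0 : ℝ) < n := by exact_mod_cast hn0
  have hn1' : (1 : ℝ) ≤ n := by exact_mod_cast hn0
  have hrate := natCast_mul_rpow_volume_rate d ν hn0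
  set R : ℝ := (n : ℝ) ^ (-(((d : ℝ) + 1) / ((d : ℝ) + 2)) + ν) with hR
  have hR0 : 0 < R := Real.rpow_pos_of_pos hn' _
  have hRinv : 1 ≤ n * R := by
    rw [hrate]
    exact Real.one_le_rpow hn1' (by positivity)
  have hexp : Real.exp (-(n * (κ * (c * R)) / 8)) =
      Real.exp (-(κ * c / 8 * (n : ℝ) ^ (β + ν))) := by
    rw [← hrate]
    congr 1
    ring
  have hQ : ((Q n).card : ℝ) ≤ C * (1 / n * Real.exp (1 / 2 * (n : ℝ) ^ (β - ν))) := by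
    rw [Real.norm_of_nonneg (by positivity), Real.norm_of_nonneg (by positivity)] at hn1
    refine hn1.trans ?_
    gcongr
    have : 0 ≤ (n : ℝ) ^ α := by positivity
    linarith
  -- The ratio of the two powers is n^{-2ν} → 0, so the entropy term ½n^{β-ν} uses at most half of
  -- the Chernoff exponent.
  have hpow : (n : ℝ) ^ (β - ν) ≤ κ * c / 8 * (n : ℝ) ^ (β + ν) := by
    have : (n : ℝ) ^ (β - ν) = (n : ℝ) ^ (-(2 * ν)) * (n : ℝ) ^ (β + ν) := by
      rw [← Real.rpow_add hn']
      congr 1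
      ring
    rw [this]
    gcongr
  calc ((Q n).card : ℝ) * (V / (c * R) * Real.exp (-(n * (κ * (c * R)) / 8)))
      ≤ C * (1 / n * Real.exp (1 / 2 * (n : ℝ) ^ (β - ν))) *
          (V / (c * R) * Real.exp (-(κ * c / 8 * (n : ℝ) ^ (β + ν)))) := by
        rw [hexp]
        gcongr
    _ = C * (V / c) * (1 / (n * R)) * Real.exp (1 / 2 * (n : ℝ) ^ (β - ν) -
          κ * c / 8 * (n : ℝ) ^ (β + ν)) := by
        rw [Real.exp_sub, Real.exp_neg]
        field_simp
    _ ≤ C * (V / c) * 1 * Real.exp (-(κ * c / 16 * (n : ℝ) ^ (β + ν))) := by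
        gcongr
        · rw [div_le_one (by positivity)]
          exact hRinv
        · linarith
    _ = _ := by ring

/-- The probability that a subsample misses a leaf is smaller than any power of `n`. -/
lemma eventually_exp_neg_le_rpow {d : ℕ} {ν c γ : ℝ} (hν : 0 < ν) (hc : 0 < c) {m : ℕ → ℕ}
    (hmrate : ∀ᶠ n : ℕ in atTop,
      (n : ℝ) ^ (((d : ℝ) + 1) / ((d : ℝ) + 2)) * Real.log n ≤ (m n : ℝ)) :
    ∀ᶠ n : ℕ in atTop, Real.exp (-(m n *
      (n * (c * (n : ℝ) ^ (-(((d : ℝ) + 1) / ((d : ℝ) + 2)) + ν))) / n : ℝ)) ≤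
        (n : ℝ) ^ (-γ) := by
  have h1 : ∀ᶠ n : ℕ in atTop, γ / c ≤ (n : ℝ) ^ ν :=
    (tendsto_natCast_rpow_atTop hν).eventually_ge_atTop _
  filter_upwards [hmrate, h1, eventually_gt_atTop 0] with n hn1 hn2 hn0
  have hn' : (0 : ℝ) < n := by exact_mod_cast hn0
  have hlog : 0 ≤ Real.log n := Real.log_natCast_nonneg n
  rw [Real.rpow_def_of_pos hn' (-γ)]
  refine Real.exp_le_exp.2 ?_
  set R : ℝ := (n : ℝ) ^ (-(((d : ℝ) + 1) / ((d : ℝ) + 2)) + ν) with hR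
  have hR0 : 0 < R := Real.rpow_pos_of_pos hn' _
  have h2 : (n : ℝ) ^ (((d : ℝ) + 1) / ((d : ℝ) + 2)) * R = (n : ℝ) ^ ν := by
    rw [hR, ← Real.rpow_add hn']
    congr 1
    ring
  have h3 : (m n : ℝ) * (n * (c * R)) / n = m n * (c * R) := by field_simp
  rw [h3]
  have h4 : γ * Real.log n ≤ m n * (c * R) := by
    calc γ * Real.log n ≤ (c * (n : ℝ) ^ ν) * Real.log n := by
          gcongr
          rwa [div_le_iff₀' hc] at hn2
      _ = ((n : ℝ) ^ (((d : ℝ) + 1) / ((d : ℝ) + 2)) * Real.log n) * (c * R) := by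
          rw [← h2]; ring
      _ ≤ m n * (c * R) := by gcongr
  linarith

/-- Squared bias times the expected number of points in the ball; the exponent is (d+2)(-1/(d+2) -
ε₁) + 1 = -(d+2)ε₁. -/
lemma tendsto_bias_rate {d : ℕ} {ε₁ : ℝ} (hε₁ : 0 < ε₁) (K C p : ℝ) :
    Tendsto (fun n : ℕ => K * ((n : ℝ) ^ (-(1 / ((d : ℝ) + 2)) - ε₁)) ^ 2 *
      (n * (p * (C * (n : ℝ) ^ (-(1 / ((d : ℝ) + 2)) - ε₁)) ^ d))) atTop (𝓝 0) := by
  have h1 : Tendsto (fun n : ℕ => K * p * C ^ d * (n : ℝ) ^ (-(((d : ℝ) + 2) * ε₁))) atTop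
      (𝓝 0) := by
    simpa using (tendsto_natCast_rpow_neg (neg_neg_of_pos
      (by positivity : 0 < ((d : ℝ) + 2) * ε₁))).const_mul (K * p * C ^ d)
  refine h1.congr' ?_
  filter_upwards [eventually_gt_atTop 0] with n hn
  have hn' : (0 : ℝ) < n := by exact_mod_cast hn
  set γ : ℝ := -(1 / ((d : ℝ) + 2)) - ε₁ with hγ
  have h2 : (n : ℝ) ^ (-(((d : ℝ) + 2) * ε₁)) = ((n : ℝ) ^ γ) ^ (d + 2) * n := by
    nth_rewrite 3 [← Real.rpow_one (n : ℝ)]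
    rw [← Real.rpow_natCast, ← Real.rpow_mul hn'.le, ← Real.rpow_add hn']
    congr 1
    rw [hγ]
    push_cast
    field_simp
    ring
  rw [h2, mul_pow, pow_add]
  ring

/-- Squared maximal weight times the expected number of points in the ball; the exponent is -2/(d+2)
- 2ν + 1 - d/(d+2) - dε₁ = -(2ν + dε₁). -/
lemma tendsto_weight_rate {d : ℕ} {ε₁ ν c : ℝ} (hε₁ : 0 < ε₁) (hν : 0 < ν) (K C p : ℝ)
    (hc : 0 < c) :
    Tendsto (fun n : ℕ => K *
      (1 / (n * (c * (n : ℝ) ^ (-(((d : ℝ) + 1) / ((d : ℝ) + 2)) + ν)))) ^ 2 *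
      (n * (p * (C * (n : ℝ) ^ (-(1 / ((d : ℝ) + 2)) - ε₁)) ^ d))) atTop (𝓝 0) := by
  have h1 : Tendsto (fun n : ℕ => K * p * C ^ d / c ^ 2 *
      (n : ℝ) ^ (-(2 * ν + d * ε₁))) atTop (𝓝 0) := by
    simpa using (tendsto_natCast_rpow_neg (neg_neg_of_pos
      (by positivity : 0 < 2 * ν + d * ε₁))).const_mul (K * p * C ^ d / c ^ 2)
  refine h1.congr' ?_
  filter_upwards [eventually_gt_atTop 0] with n hn
  have hn' : (0 : ℝ) < n := by exact_mod_cast hn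
  have hrate := natCast_mul_rpow_volume_rate d ν hn
  rw [mul_left_comm (n : ℝ) c, hrate]
  set γ : ℝ := -(1 / ((d : ℝ) + 2)) - ε₁ with hγ
  have h2 : (n : ℝ) ^ (-(2 * ν + d * ε₁)) * ((n : ℝ) ^ (1 / ((d : ℝ) + 2) + ν)) ^ 2 =
      ((n : ℝ) ^ γ) ^ d * n := by
    nth_rewrite 4 [← Real.rpow_one (n : ℝ)]
    rw [← Real.rpow_natCast, ← Real.rpow_natCast, ← Real.rpow_mul hn'.le, ← Real.rpow_mul hn'.le,
      ← Real.rpow_add hn', ← Real.rpow_add hn']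
    congr 1
    rw [hγ]
    push_cast
    field_simp
    ring
  have hpos : (n : ℝ) ^ (1 / ((d : ℝ) + 2) + ν) ≠ 0 := (Real.rpow_pos_of_pos hn' _).ne'
  rw [← eq_div_iff (pow_ne_zero 2 hpos)] at h2
  rw [h2, mul_pow]
  field_simp

end Rates

/-! ### From bounds on the good event to convergence in probability -/

section Main

variable {Ω : Type*} {d : ℕ}

lemma leafCount_sample_eq_hitCount {f : Cov d → ℝ} {X : ℕ → Ω → Cov d} {ε : ℕ → Ω → ℝ} (n : ℕ)
    (ω : Ω) {q : TreeStructure d} {A : Set (Cov d)} (hA : A ∈ q.leaves) {z : Cov d} (hz : z ∈ A) :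
    leafCount (sample f X ε n ω) q z = hitCount X A n ω := by
  classical
  unfold leafCount hitCount
  congr 1
  ext i
  simp only [Finset.mem_filter, Finset.mem_univ, true_and]
  exact q.sameLeaf_iff_mem hA hz

variable [MeasurableSpace Ω] {P : Measure Ω} [IsProbabilityMeasure P]

/-- Events that are covered by a vanishing event and a Markov event have vanishing probability. -/
lemma tendsto_measureReal_of_subset {X : ℕ → Ω → Cov d} (hX : ∀ i, Measurable (X i))
    {bad T : ℕ → Set Ω} {ball : ℕ → Set (Cov d)} (hball : ∀ n, MeasurableSet (ball n))
    {w p : ℕ → ℝ} (hw : ∀ n, 0 ≤ w n) (hp : ∀ n i, P.real (X i ⁻¹' ball n) ≤ p n) {τ : ℝ}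
    (hτ : 0 < τ) (hsub : ∀ᶠ n in atTop, T n ⊆ bad n ∪ {ω | τ ≤ w n * hitCount X (ball n) n ω})
    (hbad : Tendsto (fun n => P.real (bad n)) atTop (𝓝 0))
    (hlim : Tendsto (fun n : ℕ => w n * (n * p n)) atTop (𝓝 0)) :
    Tendsto (fun n => P.real (T n)) atTop (𝓝 0) := by
  have h1 : Tendsto (fun n : ℕ => P.real (bad n) + w n * (n * p n) / τ) atTop (𝓝 0) := by
    simpa using hbad.add (hlim.div_const τ)
  refine squeeze_zero' (Eventually.of_forall fun n => measureReal_nonneg) ?_ h1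
  filter_upwards [hsub] with n hn
  refine (measureReal_mono hn).trans ((measureReal_union_le _ _).trans ?_)
  gcongr
  exact measureReal_le_mul_hitCount_le hX (hball n) (hp n) (hw n) hτ n

/-- Turns the lower bound for ‖r_n‖ into a bound linear in the count `N`, ready for Markov. The
hypothesis excludes `r = 0`. -/
lemma div_sq_le_mul_of_one_le {r B c N t : ℝ} (h : 1 ≤ c * r ^ 2 * N) (ht : |t| ≤ B) :
    (t / r) ^ 2 ≤ B ^ 2 * c * N := by
  have hr : 0 < r ^ 2 := by
    rcases eq_or_ne r 0 with rfl | hr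
    · norm_num at h
    · positivity
  have hB : t ^ 2 ≤ B ^ 2 := by
    rw [← sq_abs]
    exact pow_le_pow_left₀ (abs_nonneg t) ht 2
  rw [div_pow, div_le_iff₀ hr]
  calc t ^ 2 ≤ B ^ 2 := hB
    _ ≤ B ^ 2 * (c * r ^ 2 * N) := le_mul_of_one_le_right (sq_nonneg B) h
    _ = B ^ 2 * c * N * r ^ 2 := by ring

end Main

end Boulevard

/-! ### Asymptotic normality -/

theorem theorem4 {Ω : Type*} [MeasurableSpace Ω] (P : Measure Ω) [IsProbabilityMeasure P]
    (d : ℕ) (hd : 0 < d)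
    -- the covariates: i.i.d. with a density on the unit cube bounded above and away from zero
    (X : ℕ → Ω → Boulevard.Cov d) (hX : ∀ i, Measurable (X i))
    (hXcube : ∀ i ω, X i ω ∈ Boulevard.unitCube d)
    (dens : Boulevard.Cov d → ℝ) (hdens : Measurable dens) (c₁ c₂ : ℝ) (hc₁ : 0 < c₁)
    (hdens_bound : ∀ z ∈ Boulevard.unitCube d, c₁ ≤ dens z ∧ dens z ≤ c₂)
    (hXlaw : ∀ i, P.map (X i) =
      (volume.restrict (Boulevard.unitCube d)).withDensity (fun z => ENNReal.ofReal (dens z)))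
    -- the Lipschitz regression function
    (f : Boulevard.Cov d → ℝ) (L : ℝ≥0) (hf : LipschitzOnWith L f (Boulevard.unitCube d))
    -- the errors: i.i.d., sub-Gaussian, centred, with variance `σ²`, independent of the covariates
    (ε : ℕ → Ω → ℝ) (hε : ∀ i, Measurable (ε i))
    (hεident : ∀ i, IdentDistrib (ε i) (ε 0) P P)
    (proxy : ℝ≥0) (hεsub : HasSubgaussianMGF (ε 0) proxy P)
    (hεmean : ∫ ω, ε 0 ω ∂P = 0) (σ : ℝ≥0) (hεvar : ∫ ω, (ε 0 ω) ^ 2 ∂P = (σ : ℝ) ^ 2)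
    (hXε : ∀ i, IndepFun (X i) (ε i) P)
    (hindep : iIndepFun (fun i ω => (X i ω, ε i ω)) P)
    -- the learning rate
    (lam : ℝ) (hlam₀ : 0 < lam) (hlam₁ : lam < 1)
    -- the tree spaces, with their distributions given the sample
    (Q : ℕ → Finset (Boulevard.TreeStructure d))
    (law : (n : ℕ) → Boulevard.Sample d n → PMF (Q n))
    (hlaw : ∀ n q, Measurable fun s => law n s q)
    (hiso : ∀ n, Boulevard.StructureValueIsolation (law n))
    -- the subsample sizes
    (m : ℕ → ℕ) (hm : ∀ n, m n ≤ n)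
    (hmrate : ∀ᶠ n : ℕ in atTop,
      (n : ℝ) ^ (((d : ℝ) + 1) / ((d : ℝ) + 2)) * Real.log n ≤ (m n : ℝ))
    -- the random tree structures and subsamples
    (tree : (n : ℕ) → ℕ → Ω → Q n) (htree : ∀ n b q, MeasurableSet {ω | tree n b ω = q})
    (sub : (n : ℕ) → ℕ → Ω → Finset (Fin n))
    (hsub : ∀ n b w, MeasurableSet {ω | sub n b ω = w})
    (hnonadapt : ∀ n, Boulevard.NonAdaptive P (law n) (Boulevard.sample f X ε n) (tree n) (sub n))
    (hsubunif : ∀ n,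
      Boulevard.UniformSubsampling P (m n) (Boulevard.sample f X ε n) (tree n) (sub n))
    -- the rates
    (ε₁ ν α : ℝ) (hε₁ : 0 < ε₁) (hν : 0 < ν) (hα : 0 < α)
    (hdiam : Boulevard.LeafDiameterRate Q ε₁)
    (hvol : Boulevard.LeafVolumeRate Q ν)
    (hcard : Boulevard.TreeSpaceRate Q ν α)
    -- the truncation levels, large compared with the responses
    (M : (n : ℕ) → Boulevard.Sample d n → ℝ≥0∞) (hMmeas : ∀ n, Measurable (M n))
    (hM : ∀ n s i, ENNReal.ofReal (|(s i).2| / (1 - lam)) ≤ M n s)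
    -- the point of interest
    (x : Boulevard.Cov d) (hx : x ∈ Boulevard.unitCube d) :
    (∀ n, ∀ᵐ ω ∂P, ∃ l : ℝ, Tendsto
      (fun b : ℕ => Boulevard.iterate lam (M n (Boulevard.sample f X ε n ω))
        (Boulevard.sample f X ε n ω) (fun j => (tree n j ω).1) (fun j => sub n j ω) b x)
      atTop (𝓝 l)) ∧
    TendstoInDistribution
      (fun (n : ℕ) (ω : Ω) =>
        (Boulevard.prediction lam (M n (Boulevard.sample f X ε n ω))
            (Boulevard.sample f X ε n ω) (fun j => (tree n j ω).1) (fun j => sub n j ω) x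
          - lam / (1 + lam) * f x) /
        ‖Boulevard.ridgeWeights lam (Boulevard.sample f X ε n ω)
            (law n (Boulevard.sample f X ε n ω)) (m n) x‖)
      atTop (id : ℝ → ℝ) (fun _ => P) (gaussianReal 0 (σ ^ 2)) := by
  classical
  -- Off the cube `f` is arbitrary and perhaps not measurable; a Lipschitz extension agrees with it
  -- at every covariate.
  obtain ⟨g, hgL, hgf⟩ := hf.extend_real
  have hfg : ∀ i ω, f (X i ω) = g (X i ω) := fun i ω => hgf (hXcube i ω)
  have hgm : Measurable g := hgL.continuous.measurable
  have hfX : ∀ i, Measurable fun ω => f (X i ω) := fun i => by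
    simp only [hfg]
    exact hgm.comp (hX i)
  have hS : ∀ n, Measurable (Boulevard.sample f X ε n) := fun n =>
    measurable_pi_lambda _ fun i => (hX i).prodMk ((hfX i).add (hε i))
  have hconv := fun n => Boulevard.ae_tendsto_iterate (hS n) (hlaw n) (htree n) (hsub n)
    (hnonadapt n) (hsubunif n) hlam₀ hlam₁ (hM n) x
  refine ⟨fun n => (hconv n).mono fun ω hω => ⟨_, hω⟩, ?_⟩
  -- the ridge weights as a function of the covariates
  set r : (n : ℕ) → (Fin n → Boulevard.Cov d) → EuclideanSpace ℝ (Fin n) := fun n xs =>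
    Boulevard.ridgeWeights lam (fun i => (xs i, 0)) (law n fun i => (xs i, 0)) (m n) x with hr
  have hrS : ∀ n ω, Boulevard.ridgeWeights lam (Boulevard.sample f X ε n ω)
      (law n (Boulevard.sample f X ε n ω)) (m n) x = r n (fun i => X i ω) := fun n ω =>
    Boulevard.ridgeWeights_congr (fun _ => rfl) (hiso n _ _ fun _ => rfl)
  have hrm : ∀ n, Measurable (r n) := fun n => by
    have h1 : Measurable fun xs : Fin n → Boulevard.Cov d => fun i => (xs i, (0 : ℝ)) :=
      measurable_pi_lambda _ fun i => (measurable_pi_apply i).prodMk measurable_const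
    exact (Boulevard.measurable_ridgeWeights (hlaw n) (m n) lam x).comp h1
  have hXv : ∀ n, Measurable fun ω => fun i : Fin n => X i ω := fun n =>
    measurable_pi_lambda _ fun i => hX i
  set a : (n : ℕ) → (Fin n → Boulevard.Cov d) → Fin n → ℝ := fun n xs i =>
    r n xs i / ‖r n xs‖ with ha
  have ham : ∀ n i, Measurable fun xs => a n xs i := fun n i =>
    ((by fun_prop : Measurable fun v : EuclideanSpace ℝ (Fin n) => v i).comp (hrm n)).div
      (hrm n).norm
  set θ := lam / (1 + lam) with hθ
  set bias : (n : ℕ) → Ω → ℝ := fun n ω =>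
    (∑ i, r n (fun i => X i ω) i * f (X i ω) - θ * f x) / ‖r n (fun i => X i ω)‖ with hbias
  have hbiasm : ∀ n, Measurable (bias n) := fun n => by
    refine Measurable.div (Measurable.sub (Finset.measurable_sum _ fun i _ => ?_)
      measurable_const) ((hrm n).comp (hXv n)).norm
    exact ((by fun_prop : Measurable fun v : EuclideanSpace ℝ (Fin n) => v i).comp
      ((hrm n).comp (hXv n))).mul (hfX i)
  -- the bound on the regression function
  obtain ⟨B, hB⟩ : ∃ B, ∀ z ∈ Boulevard.unitCube d, |f z| ≤ B := by
    obtain ⟨R, hR⟩ := (Boulevard.isBounded_unitCube (d := d)).subset_closedBall x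
    refine ⟨|f x| + L * R, fun z hz => ?_⟩
    have h1 := hf.dist_le_mul z hz x hx
    have h2 : dist z x ≤ R := hR hz
    have h3 := abs_sub_abs_le_abs_sub (f z) (f x)
    rw [Real.dist_eq] at h1
    have h4 : (L : ℝ) * dist z x ≤ L * R := by gcongr
    linarith
  have hB0 : 0 ≤ B := (abs_nonneg _).trans (hB x hx)
  -- the rates
  obtain ⟨C, hC⟩ := hdiam
  obtain ⟨c, hc, hc'⟩ := hvol
  set D : ℕ → ℝ := fun n => max C 0 * (n : ℝ) ^ (-(1 / ((d : ℝ) + 2)) - ε₁) with hD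
  have hD0 : ∀ n, 0 ≤ D n := fun n => by positivity
  have hdiamD : ∀ᶠ n : ℕ in atTop, ∀ q ∈ Q n, ∀ A ∈ q.leaves, Metric.diam A ≤ D n := by
    filter_upwards [hC] with n hn q hq A hA
    refine (hn q hq A hA).trans ?_
    simp only [hD]
    gcongr
    exact le_max_left _ _
  -- Half of the lower bound on the expected number of covariates in a leaf: n times density `c₁`
  -- times the volume bound.
  set cnt : ℕ → ℝ := fun n =>
    n * (c₁ * c / 2 * (n : ℝ) ^ (-(((d : ℝ) + 1) / ((d : ℝ) + 2)) + ν)) with hcnt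
  have hcnt0 : ∀ n, 0 < n → 0 < cnt n := fun n hn => by
    have hn' : (0 : ℝ) < n := by exact_mod_cast hn
    have := Real.rpow_pos_of_pos hn' (-(((d : ℝ) + 1) / ((d : ℝ) + 2)) + ν)
    simp only [hcnt]
    positivity
  set bad : ℕ → Set Ω := fun n => {ω | ∃ q ∈ Q n, ∃ A ∈ q.leaves,
    (Boulevard.hitCount X A n ω : ℝ) ≤ cnt n} with hbad
  have hXindep : iIndepFun X P := hindep.comp (fun _ p => p.1) fun _ => measurable_fst
  have hbadlim : Tendsto (fun n => P.real (bad n)) atTop (𝓝 0) := by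
    refine squeeze_zero' (Eventually.of_forall fun n => measureReal_nonneg) ?_
      (Boulevard.tendsto_union_bound hν hcard hc hc₁
        (V := (volume (Boulevard.unitCube d)).toReal) ENNReal.toReal_nonneg)
    filter_upwards [hc', eventually_gt_atTop 0] with n hn hn0
    have hn' : (0 : ℝ) < n := by exact_mod_cast hn0
    have h1 := Boulevard.measureReal_exists_leaf_le hX hXindep hdens_bound hc₁ hXlaw (Q n)
      (mul_pos hc (Real.rpow_pos_of_pos hn' _)) hn n
    have h2 : cnt n = n * (c₁ * (c * (n : ℝ) ^ (-(((d : ℝ) + 1) / ((d : ℝ) + 2)) + ν))) / 2 := by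
      simp only [hcnt]
      ring
    simp only [hbad, h2]
    exact h1
  have hc₂ : 0 ≤ c₂ := hc₁.le.trans ((hdens_bound x hx).1.trans (hdens_bound x hx).2)
  set κ : ℝ := c₂ * (volume (Metric.ball (0 : Boulevard.Cov d) 1)).toReal with hκ
  have hball : ∀ n i, P.real (X i ⁻¹' Metric.closedBall x (D n)) ≤ κ * D n ^ d := fun n i =>
    Boulevard.measureReal_closedBall_le (hX i) hdens_bound (hXlaw i) hc₂ x (hD0 n)
  set cl : ℝ := 4 * (1 / lam + 1) ^ 2 with hcl
  have hcl0 : 0 ≤ cl := by positivity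
  have hpos : 0 < 1 - lam := by linarith
  set C₁ : ℝ := 1 / (1 - lam) * (L * max C 0 + B) with hC₁
  -- on the good event the weights and the bias are small
  have hmiss := Boulevard.eventually_exp_neg_le_rpow (d := d) (γ := 1 / ((d : ℝ) + 2) + ε₁) hν
    (by positivity : 0 < c₁ * c / 2) hmrate
  have hhalf : ∀ᶠ n : ℕ in atTop, (n : ℝ) ^ (-(1 / ((d : ℝ) + 2) + ε₁)) < 1 / 2 :=
    (Boulevard.tendsto_natCast_rpow_neg
      (neg_neg_of_pos (by positivity))).eventually_lt_const (by norm_num)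
  have hgood : ∀ᶠ n : ℕ in atTop, ∀ ω ∉ bad n,
      1 ≤ cl * ‖r n (fun i => X i ω)‖ ^ 2 *
        Boulevard.hitCount X (Metric.closedBall x (D n)) n ω ∧
      (∀ i, |r n (fun i => X i ω) i| ≤ lam / (1 - lam) * (1 / cnt n)) ∧
      |∑ i, r n (fun i => X i ω) i * f (X i ω) - θ * f x| ≤
        C₁ * (n : ℝ) ^ (-(1 / ((d : ℝ) + 2)) - ε₁) := by
    filter_upwards [hdiamD, hmiss, hhalf, eventually_gt_atTop 0] with n hn1 hn2 hn3 hn0 ω hω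
    have hcount : ∀ q ∈ Q n, ∀ z ∈ Boulevard.unitCube d,
        cnt n ≤ Boulevard.leafCount (Boulevard.sample f X ε n ω) q z := by
      intro q hq z hz
      obtain ⟨A, hA, hzA⟩ := q.exists_mem_leaf hz
      rw [Boulevard.leafCount_sample_eq_hitCount n ω hA hzA]
      by_contra hlt
      exact hω ⟨q, hq, A, hA, (not_le.1 hlt).le⟩
    have hs : ∀ i, (Boulevard.sample f X ε n ω i).1 ∈ Boulevard.unitCube d :=
      fun i => hXcube i ω
    refine ⟨?_, fun i => ?_, ?_⟩
    · rw [← hrS n ω]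
      exact Boulevard.one_le_norm_ridgeWeights_sq_mul hlam₀ hlam₁ (hm n)
        (fun q hq => hcount q hq x hx) hn1 (hn2.trans hn3.le)
    · rw [← hrS n ω]
      exact Boulevard.abs_ridgeWeights_le hlam₀ hlam₁ (hcnt0 n hn0)
        (fun q hq => hcount q hq x hx) i
    · rw [← hrS n ω]
      refine (Boulevard.abs_bias_le hlam₀ hlam₁ (hm n) hf hB hs hx hcount hn1 (hD0 n)).trans ?_
      -- The probability of missing a leaf is bounded at the diameter rate, so both terms of the
      -- bias share one power of `n`.
      have h1 : Real.exp (-(m n * cnt n / n : ℝ)) ≤ (n : ℝ) ^ (-(1 / ((d : ℝ) + 2)) - ε₁) := by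
        rw [← neg_add']
        exact hn2
      rw [hC₁, mul_assoc]
      gcongr
      rw [add_mul, mul_assoc]
      gcongr
  -- the central limit theorem for the noise
  have hclt := Boulevard.tendstoInDistribution_weighted_sum (v := σ ^ 2) hX hε hεident
    (by simpa using hεsub.memLp 2) hεmean (by simpa using hεvar) hXε hindep ham (fun δ hδ => by
      refine Boulevard.tendsto_measureReal_of_subset hX (bad := bad)
        (ball := fun n => Metric.closedBall x (D n))
        (w := fun n => (lam / (1 - lam) * (1 / cnt n)) ^ 2 * cl) (p := fun n => κ * D n ^ d)
        (fun n => measurableSet_closedBall) (fun n => by positivity) hball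
        (by positivity : 0 < δ ^ 2) ?_ hbadlim ?_
      · filter_upwards [hgood] with n hn ω hω
        by_contra hcon
        rw [Set.mem_union, not_or] at hcon
        obtain ⟨hω1, hω2⟩ := hcon
        obtain ⟨h1, h2, -⟩ := hn ω hω1
        rw [Set.mem_ofPred_eq, not_le] at hω2
        refine hω ⟨?_, fun i => ?_⟩
        · have hne : ‖r n (fun i => X i ω)‖ ≠ 0 := by
            intro h0
            rw [h0] at h1
            norm_num at h1
          simp only [ha, div_pow]
          rw [← Finset.sum_div, div_eq_one_iff_eq (by positivity), EuclideanSpace.norm_sq_eq]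
          simp
        · refine abs_le_of_sq_le_sq ?_ hδ.le
          exact (Boulevard.div_sq_le_mul_of_one_le h1 (h2 i)).trans hω2.le
      · have h1 := Boulevard.tendsto_weight_rate (d := d) hε₁ hν
          ((lam / (1 - lam)) ^ 2 * cl) (max C 0) κ (by positivity : 0 < c₁ * c / 2)
        refine h1.congr fun n => ?_
        simp only [hcnt, hD]
        ring)
  -- the bias is negligible
  have hbias0 : TendstoInMeasure P bias atTop 0 := by
    rw [tendstoInMeasure_iff_measureReal_norm]
    intro τ hτ
    refine Boulevard.tendsto_measureReal_of_subset hX (bad := bad)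
      (ball := fun n => Metric.closedBall x (D n))
      (w := fun n => (C₁ * (n : ℝ) ^ (-(1 / ((d : ℝ) + 2)) - ε₁)) ^ 2 * cl)
      (p := fun n => κ * D n ^ d)
      (fun n => measurableSet_closedBall) (fun n => by positivity) hball
      (by positivity : 0 < τ ^ 2) ?_ hbadlim ?_
    · filter_upwards [hgood] with n hn ω hω
      by_contra hcon
      rw [Set.mem_union, not_or] at hcon
      obtain ⟨hω1, hω2⟩ := hcon
      obtain ⟨h1, -, h3⟩ := hn ω hω1
      apply hω2
      rw [Set.mem_ofPred_eq, Pi.zero_apply, sub_zero, Real.norm_eq_abs] at hω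
      rw [Set.mem_ofPred_eq]
      calc τ ^ 2 ≤ |bias n ω| ^ 2 := pow_le_pow_left₀ hτ.le hω 2
        _ = bias n ω ^ 2 := sq_abs _
        _ ≤ _ := Boulevard.div_sq_le_mul_of_one_le h1 h3
    · have h1 := Boulevard.tendsto_bias_rate (d := d) hε₁ (C₁ ^ 2 * cl) (max C 0) κ
      refine h1.congr fun n => ?_
      simp only [hD]
      ring
  -- Slutsky: the prediction error is the weighted noise plus a term that vanishes in probability.
  have hsum := tendstoInDistribution_of_tendstoInMeasure_sub
    (fun (n : ℕ) ω => ∑ i : Fin n, a n (fun i => X i ω) i * ε i ω + bias n ω) _ hclt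
    (by
      refine hbias0.congr_left fun n => Eventually.of_forall fun ω => ?_
      simp)
    (fun n => (hclt.forall_aemeasurable n).add (hbiasm n).aemeasurable)
  refine hsum.congr (fun n => ?_) (EventuallyEq.refl _ _)
  filter_upwards [hconv n] with ω hω
  -- Almost surely the limit is r·y, and y = f(X) + ε splits it into noise and bias.
  rw [Boulevard.prediction, hω.limUnder_eq, hrS n ω]
  simp only [ha, hbias, Boulevard.sample]
  simp only [div_mul_eq_mul_div, ← Finset.sum_div, ← add_div, mul_add, Finset.sum_add_distrib]
  congr 1
  ring
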